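/- Let $(S,\mathfrak A,\mu)$ and $(T,\mathfrak B,\nu)$ be measure spaces with $\sigma$-finite measures. For $h\in L^2(\mu\times\nu)$ let $\mathcal I_h:L^2(\nu)\to L^2(\mu)$ be the integral operator $(\mathcal I_hf)(s)=\int_T h(s,t)f(t)\,d\nu(t)$, and let $\|\mathcal I_h\|_{\boldsymbol S_1}$ be its trace norm, equal to $\infty$ if $\mathcal I_h$ is not of trace class. Let $\mathfrak M(\mu,\nu)$ be the set of $\mu\times\nu$-measurable functions $\Phi:S\times T\to\mathbb C$ such that for every $h\in L^2(\mu\times\nu)$ with $\mathcal I_h$ of trace class one has $\Phi h\in L^2(\mu\times\nu)$ and $\mathcal I_{\Phi h}$ is of trace class; let $\|\Phi\|_{\mathfrak M(\mu,\nu)}$ be the smallest $c\ge 0$ such that $\|\mathcal I_{\Phi h}\|_{\boldsymbol S_1}\le c\,\|\mathcal I_h\|_{\boldsymbol S_1}$ for all $h\in L^2(\mu\times\nu)$ (with $\|\mathcal I_{\Phi h}\|_{\boldsymbol S_1}=\infty$ if $\Phi h\notin L^2(\mu\times\nu)$, and $0\cdot\infty=0$). Let $\mathfrak M(S\times T)$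 be the set of discrete Schur multipliers on $\mathcal B(\ell^2(T),\ell^2(S))$, that is, of functions $\Psi:S\times T\to\mathbb C$ such that, whenever $\{a(s,t)\}$ is the matrix of a bounded operator $A:\ell^2(T)\to\ell^2(S)$, the matrix $\{\Psi(s,t)a(s,t)\}$ also is the matrix of a bounded operator $M_\Psi A:\ell^2(T)\to\ell^2(S)$; let $\|\Psi\|_{\mathfrak M(S\times T)}$ be the norm of the transformer $A\mapsto M_\Psi A$ on $\mathcal B(\ell^2(T),\ell^2(S))$. Theorem. Let $\Phi\in\mathfrak M(\mu,\nu)$. Then there exists a function $\Phi_0\in\mathfrak M(S\times T)$, defined everywhere on $S\times T$, such that $\Phi_0=\Phi$ almost everywhere with respect to $\mu\times\nu$ and $$\|\Phi_0\|_{\mathfrak M(S\times T)}=\|\Phi\|_{\mathfrak M(\mu,\nu)}<\infty.$$ -/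

import Mathlib

open MeasureTheory
open scoped ENNReal NNReal

noncomputable section

/-! ### Trace class operators -/

section TraceClass

variable {E F : Type*} [NormedAddCommGroup E] [InnerProductSpace ℂ E]
  [NormedAddCommGroup F] [InnerProductSpace ℂ F]

/-- The trace (that is, nuclear) norm of a bounded operator `A` between Hilbert spaces: the infimum
of `∑ ‖u n‖ ‖v n‖` over all series `A x = ∑ ⟨v n, x⟩ u n` of rank one operators
(`inner ℂ (v n) x` is linear in `x`).  It is `∞` when there is no such series with a finite sum. -/
def traceNorm (A : E →L[ℂ] F) : ℝ≥0∞ :=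
  ⨅ (u : ℕ → F) (v : ℕ → E) (_ : ∀ x : E, HasSum (fun n => inner ℂ (v n) x • u n) (A x)),
    ∑' n, ‖u n‖ₑ * ‖v n‖ₑ

/-- `A` belongs to the trace class `𝑺₁(E, F)`. -/
def IsTraceClass (A : E →L[ℂ] F) : Prop := traceNorm A < ∞

end TraceClass

/-! ### Integral operators with square integrable kernels -/

section IntegralOperator

set_option linter.unusedSectionVars false

variable {S T : Type*} [MeasurableSpace S] [MeasurableSpace T]
  {μ : Measure S} {ν : Measure T} [SigmaFinite μ] [SigmaFinite ν]

theorem lintegral_sq_kernel {h : S × T → ℂ} (hh : MemLp h 2 (μ.prod ν)) :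
    ∫⁻ s, ∫⁻ t, ‖h (s, t)‖ₑ ^ (2 : ℝ) ∂ν ∂μ = eLpNorm h 2 (μ.prod ν) ^ (2 : ℝ) := by
  rw [eLpNorm_eq_lintegral_rpow_enorm_toReal (by norm_num) (by norm_num)]
  simp only [ENNReal.toReal_ofNat]
  rw [← ENNReal.rpow_mul]
  norm_num
  have := hh.1.enorm.pow_const 2
  rw [lintegral_prod _ this]

theorem memLp_section {h : S × T → ℂ} (hh : MemLp h 2 (μ.prod ν)) :
    ∀ᵐ s ∂μ, MemLp (fun t => h (s, t)) 2 ν := by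
  have h1 : ∀ᵐ s ∂μ, AEStronglyMeasurable (fun t => h (s, t)) ν := hh.1.prodMk_left
  have h2 : ∀ᵐ s ∂μ, ∫⁻ t, ‖h (s, t)‖ₑ ^ (2 : ℝ) ∂ν < ∞ := by
    refine ae_lt_top' ?_ ?_
    · exact (hh.1.enorm.pow_const (2 : ℝ)).lintegral_prod_right'
    · rw [lintegral_sq_kernel hh]
      exact (ENNReal.rpow_lt_top_of_nonneg (by norm_num) hh.2.ne).ne
  filter_upwards [h1, h2] with s hs1 hs2
  refine ⟨hs1, ?_⟩
  rw [eLpNorm_lt_top_iff_lintegral_rpow_enorm_lt_top (by norm_num) (by norm_num)]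
  simpa using hs2

theorem eLpNorm_kernel_integral_le {h : S × T → ℂ} (hh : MemLp h 2 (μ.prod ν)) (f : Lp ℂ 2 ν) :
    eLpNorm (fun s => ∫ t, h (s, t) * f t ∂ν) 2 μ ≤ eLpNorm h 2 (μ.prod ν) * eLpNorm f 2 ν := by
  have key : ∀ᵐ s ∂μ, ‖∫ t, h (s, t) * f t ∂ν‖ₑ ^ (2 : ℝ) ≤
      (∫⁻ t, ‖h (s, t)‖ₑ ^ (2 : ℝ) ∂ν) * eLpNorm f 2 ν ^ (2 : ℝ) := by
    filter_upwards [memLp_section hh] with s hs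
    have e1 : ‖∫ t, h (s, t) * f t ∂ν‖ₑ ≤ eLpNorm (fun t => h (s, t)) 2 ν * eLpNorm f 2 ν := by
      refine (enorm_integral_le_lintegral_enorm _).trans ?_
      rw [← eLpNorm_one_eq_lintegral_enorm]
      have e0 := eLpNorm_smul_le_mul_eLpNorm (μ := ν) (p := 2) (q := 2) (r := 1)
        (f := (f : T → ℂ)) (φ := fun t => h (s, t)) (Lp.aestronglyMeasurable f) hs.1
      exact e0
    refine (ENNReal.rpow_le_rpow e1 (by norm_num)).trans ?_
    rw [ENNReal.mul_rpow_of_nonneg _ _ (by norm_num)]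
    gcongr
    rw [eLpNorm_eq_lintegral_rpow_enorm_toReal (by norm_num) (by norm_num)]
    simp only [ENNReal.toReal_ofNat]
    rw [← ENNReal.rpow_mul]
    norm_num
  have main : eLpNorm (fun s => ∫ t, h (s, t) * f t ∂ν) 2 μ ^ (2 : ℝ) ≤
      (eLpNorm h 2 (μ.prod ν) * eLpNorm f 2 ν) ^ (2 : ℝ) := by
    rw [eLpNorm_eq_lintegral_rpow_enorm_toReal (by norm_num) (by norm_num)]
    simp only [ENNReal.toReal_ofNat]
    rw [← ENNReal.rpow_mul, ENNReal.mul_rpow_of_nonneg _ _ (by norm_num), ← lintegral_sq_kernel hh,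
      ← lintegral_mul_const']
    · simpa using lintegral_mono_ae key
    · exact (ENNReal.rpow_lt_top_of_nonneg (by norm_num) (Lp.eLpNorm_lt_top f).ne).ne
  exact (ENNReal.rpow_le_rpow_iff (by norm_num)).1 main

theorem memLp_kernel_integral {h : S × T → ℂ} (hh : MemLp h 2 (μ.prod ν)) (f : Lp ℂ 2 ν) :
    MemLp (fun s => ∫ t, h (s, t) * f t ∂ν) 2 μ := by
  refine ⟨?_, (eLpNorm_kernel_integral_le hh f).trans_lt
    (ENNReal.mul_lt_top hh.2 (Lp.eLpNorm_lt_top f))⟩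
  exact (hh.1.mul (Lp.aestronglyMeasurable f).comp_snd).integral_prod_right'

theorem integrable_section_mul {h : S × T → ℂ} (hh : MemLp h 2 (μ.prod ν)) (f : Lp ℂ 2 ν) :
    ∀ᵐ s ∂μ, Integrable (fun t => h (s, t) * f t) ν := by
  filter_upwards [memLp_section hh] with s hs
  exact hs.integrable_mul (Lp.memLp f)

/-- The integral operator `L²(ν) → L²(μ)`, `f ↦ (s ↦ ∫ h (s, t) f t dν(t))`, of a kernel
`h ∈ L²(μ × ν)`. -/
def integralOperator (h : S × T → ℂ) (hh : MemLp h 2 (μ.prod ν)) : Lp ℂ 2 ν →L[ℂ] Lp ℂ 2 μ :=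
  LinearMap.mkContinuous
    { toFun := fun f => (memLp_kernel_integral hh f).toLp (fun s => ∫ t, h (s, t) * f t ∂ν)
      map_add' := by
        intro f g
        rw [← MemLp.toLp_add]
        refine MemLp.toLp_congr _ _ ?_
        filter_upwards [integrable_section_mul hh f, integrable_section_mul hh g] with s hf hg
        rw [Pi.add_apply, ← integral_add hf hg]
        refine integral_congr_ae ?_
        filter_upwards [Lp.coeFn_add f g] with t ht
        rw [ht, Pi.add_apply, mul_add]
      map_smul' := by
        intro c f
        rw [RingHom.id_apply, ← MemLp.toLp_const_smul]
        refine MemLp.toLp_congr _ _ (Filter.Eventually.of_forall fun s => ?_)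
        simp only [Pi.smul_apply, smul_eq_mul]
        rw [← integral_const_mul]
        refine integral_congr_ae ?_
        filter_upwards [Lp.coeFn_smul c f] with t ht
        rw [ht, Pi.smul_apply, smul_eq_mul]
        ring }
    (eLpNorm h 2 (μ.prod ν)).toReal
    (by
      intro f
      change ‖(memLp_kernel_integral hh f).toLp (fun s => ∫ t, h (s, t) * f t ∂ν)‖ ≤ _
      rw [Lp.norm_toLp, Lp.norm_def, ← ENNReal.toReal_mul]
      exact ENNReal.toReal_mono (ENNReal.mul_lt_top hh.2 (Lp.eLpNorm_lt_top f)).ne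
        (eLpNorm_kernel_integral_le hh f))

/-- The defining formula of the integral operator. -/
theorem integralOperator_ae_eq (h : S × T → ℂ) (hh : MemLp h 2 (μ.prod ν)) (f : Lp ℂ 2 ν) :
    integralOperator h hh f =ᵐ[μ] fun s => ∫ t, h (s, t) * f t ∂ν :=
  (memLp_kernel_integral hh f).coeFn_toLp

end IntegralOperator

/-! ### Schur multipliers with respect to measures -/

section MeasureSchur

variable {S T : Type*} [MeasurableSpace S] [MeasurableSpace T]
  (μ : Measure S) (ν : Measure T) [SigmaFinite μ] [SigmaFinite ν]

open Classical in
/-- The trace norm of the integral operator with kernel `k`, with the value `∞` if `k` is not in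
`L²(μ × ν)` or if the operator is not of trace class. -/
def kernelTraceNorm (k : S × T → ℂ) : ℝ≥0∞ :=
  if hk : MemLp k 2 (μ.prod ν) then traceNorm (integralOperator k hk) else ∞

/-- `Φ ∈ 𝔐(μ, ν)`: the function `Φ` is measurable with respect to (the completion of) `μ × ν`, and
whenever the kernel `h ∈ L²(μ × ν)` gives a trace class operator, so does the kernel `Φ h`. -/
def IsMeasureSchurMultiplier (Φ : S × T → ℂ) : Prop :=
  AEStronglyMeasurable Φ (μ.prod ν) ∧
    ∀ (h : S × T → ℂ) (hh : MemLp h 2 (μ.prod ν)), IsTraceClass (integralOperator h hh) →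
      ∃ hΦh : MemLp (fun z => Φ z * h z) 2 (μ.prod ν),
        IsTraceClass (integralOperator (fun z => Φ z * h z) hΦh)

/-- `‖Φ‖_{𝔐(μ, ν)}`: the smallest `c ≥ 0` such that multiplication of the kernel by `Φ` increases
the trace norm of the integral operator at most `c` times (`∞` if there is no such `c`). -/
def measureSchurNorm (Φ : S × T → ℂ) : ℝ≥0∞ :=
  ⨅ (c : ℝ≥0) (_ : ∀ h : S × T → ℂ, MemLp h 2 (μ.prod ν) →
      kernelTraceNorm μ ν (fun z => Φ z * h z) ≤ c * kernelTraceNorm μ ν h), (c : ℝ≥0∞)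

end MeasureSchur

/-! ### Discrete Schur multipliers -/

section DiscreteSchur

variable {S T : Type*}

open Classical in
/-- The entry `a(s, t)` of the matrix of a bounded operator `A : ℓ²(T) → ℓ²(S)`. -/
def matrixEntry (A : lp (fun _ : T => ℂ) 2 →L[ℂ] lp (fun _ : S => ℂ) 2) (s : S) (t : T) : ℂ :=
  A (lp.single 2 t (1 : ℂ)) s

/-- `B` is the bounded operator induced by the matrix `{Φ(s, t) a(s, t)}`, where `{a(s, t)}` is the
matrix of `A`; that is, `B = M_Φ A`.  (There is at most one such `B`.) -/
def IsSchurProduct (Φ : S × T → ℂ) (A B : lp (fun _ : T => ℂ) 2 →L[ℂ] lp (fun _ : S => ℂ) 2) :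
    Prop :=
  ∀ s t, matrixEntry B s t = Φ (s, t) * matrixEntry A s t

/-- `Φ ∈ 𝔐(S × T)`: the function `Φ` is a Schur multiplier on the bounded operators
`ℓ²(T) → ℓ²(S)`. -/
def IsDiscreteSchurMultiplier (Φ : S × T → ℂ) : Prop :=
  ∀ A : lp (fun _ : T => ℂ) 2 →L[ℂ] lp (fun _ : S => ℂ) 2, ∃ B, IsSchurProduct Φ A B

/-- `‖Φ‖_{𝔐(S × T)}`: the norm of the transformer `A ↦ M_Φ A` in the operator norm, that is, the
smallest `c ≥ 0` with `‖M_Φ A‖ ≤ c ‖A‖` for all `A` (`∞` if there is no such `c`). -/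
def discreteSchurNorm (Φ : S × T → ℂ) : ℝ≥0∞ :=
  ⨅ (c : ℝ≥0) (_ : ∀ A : lp (fun _ : T => ℂ) 2 →L[ℂ] lp (fun _ : S => ℂ) 2,
      ∃ B, IsSchurProduct Φ A B ∧ ‖B‖ ≤ c * ‖A‖), (c : ℝ≥0∞)

end DiscreteSchur

end

/-! Both multiplier norms are governed by one trilinear estimate. By trace duality, the trace norm
of an operator is at most `C` exactly when its pairings with finite rank operators `K` are at most
`C ‖K‖` (`pairingBound_of_traceNorm_le`, `PairingBound.traceNorm_le`). Since trace class operators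
are absolutely convergent sums of rank one operators, only kernels `Φ (f ⊗ g)` need testing. This is
`TensorFormBound`; that some finite constant works follows from the closed graph theorem and two
applications of uniform boundedness (`exists_tensorFormBound`).

From measures to points: average `Φ` against densities `p s ⊗ q t`. A Cauchy-Schwarz factorization
of the weighted densities turns a finite Schur form of the averages into a trace pairing for `Φ`, so
the averages form a discrete multiplier with the same constant, defined at every point
(`TensorFormBound.finiteSchurBound_average`). Averages over the cells of finite grids approximate
`Φ` in `L¹` on sets of finite measure. Choosing summable errors gives convergence almost everywhere,
and a limit along an ultrafilter gives a value everywhere without increasing the constant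
(`exists_ae_eq_finiteSchurBound`).

From points to measures: for step functions the trace pairing is a Schur form whose symbol consists
of cell averages. Such an average is the expected value of the symbol at independent random points
of the cells; disjoint cells give distinct points, hence a submatrix of the discrete multiplier
(`FiniteSchurBound.norm_sum_average_le`). Density of step functions yields
`FiniteSchurBound.tensorFormBound`, and summation over rank one terms yields
`FiniteSchurBound.kernelTraceNorm_le`.

The first direction with a crude constant, followed by the second, shows that the measure norm is
finite. Repeating the first direction with that norm as the constant produces `Φ₀`, and the second
direction gives the opposite inequality. -/

/-! ### Duality between the trace norm and the operator norm on finite rank operators. -/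

section TraceDuality

variable {E F : Type*} [NormedAddCommGroup E] [InnerProductSpace ℂ E]
  [NormedAddCommGroup F] [InnerProductSpace ℂ F]

open InnerProductSpace

/-- The trace pairing of `A` with finite rank operators is bounded by `C` times the operator
norm. -/
def PairingBound (A : E →L[ℂ] F) (C : ℝ) : Prop :=
  ∀ (n : ℕ) (w : Fin n → F) (e : Fin n → E),
    ‖∑ k, inner ℂ (w k) (A (e k))‖ ≤ C * ‖∑ k, rankOne ℂ (e k) (w k)‖

theorem PairingBound.fintype {A : E →L[ℂ] F} {C : ℝ} (h : PairingBound A C) {ι : Type*} [Fintype ι]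
    (w : ι → F) (e : ι → E) :
    ‖∑ k, inner ℂ (w k) (A (e k))‖ ≤ C * ‖∑ k, rankOne ℂ (e k) (w k)‖ := by
  have := h _ (w ∘ (Fintype.equivFin ι).symm) (e ∘ (Fintype.equivFin ι).symm)
  simp only [Function.comp_apply] at this
  rwa [(Fintype.equivFin ι).symm.sum_comp (fun k => inner ℂ (w k) (A (e k))),
    (Fintype.equivFin ι).symm.sum_comp (fun k => rankOne ℂ (e k) (w k))] at this

/-- The pairing with `K` is the trace of `A K`, which the series for `A` expands as `∑ ⟨v m, K (u
m)⟩`. -/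
theorem norm_pairing_le_of_hasSum {A : E →L[ℂ] F} {u : ℕ → F} {v : ℕ → E}
    (h : ∀ x : E, HasSum (fun n => inner ℂ (v n) x • u n) (A x))
    (hs : ∑' n, ‖u n‖ₑ * ‖v n‖ₑ ≠ ∞) :
    PairingBound A (∑' n, ‖u n‖ₑ * ‖v n‖ₑ).toReal := by
  intro n w e
  set K : F →L[ℂ] E := ∑ k, rankOne ℂ (e k) (w k) with hK
  have e1 : HasSum (fun m => inner ℂ (v m) (K (u m))) (∑ k, inner ℂ (w k) (A (e k))) := by
    have : ∀ k ∈ Finset.univ, HasSum (fun m => inner ℂ (w k) (inner ℂ (v m) (e k) • u m))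
        (inner ℂ (w k) (A (e k))) := fun k _ => (h (e k)).mapL (innerSL ℂ (w k))
    convert hasSum_sum this using 2 with m
    simp [hK, mul_comm]
  have hsum : Summable (fun n => ‖u n‖ * ‖v n‖) := by
    have := ENNReal.summable_toReal hs
    simpa using this
  have e2 : (∑' n, ‖u n‖ₑ * ‖v n‖ₑ).toReal = ∑' n, ‖u n‖ * ‖v n‖ := by
    rw [ENNReal.tsum_toReal_eq (fun n => by finiteness)]
    simp
  rw [← e1.tsum_eq, e2, mul_comm, ← tsum_mul_left]
  refine tsum_of_norm_bounded (hsum.mul_left ‖K‖).hasSum fun m => ?_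
  calc ‖inner ℂ (v m) (K (u m))‖ ≤ ‖v m‖ * ‖K (u m)‖ := norm_inner_le_norm _ _
    _ ≤ ‖v m‖ * (‖K‖ * ‖u m‖) := by gcongr; exact K.le_opNorm _
    _ = _ := by ring

theorem pairingBound_of_traceNorm_le {A : E →L[ℂ] F} {C : ℝ≥0} (h : traceNorm A ≤ C) :
    PairingBound A C := by
  intro n w e
  have key : ∀ ε : ℝ≥0, 0 < ε → ‖∑ k, inner ℂ (w k) (A (e k))‖ ≤
      (C + ε) * ‖∑ k, rankOne ℂ (e k) (w k)‖ := by
    intro ε hε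
    have h1 : traceNorm A < (C + ε : ℝ≥0) := h.trans_lt (by exact_mod_cast lt_add_of_pos_right C hε)
    simp only [traceNorm, iInf_lt_iff] at h1
    obtain ⟨u, v, huv, hlt⟩ := h1
    refine (norm_pairing_le_of_hasSum huv hlt.ne_top n w e).trans ?_
    gcongr
    exact ENNReal.toReal_le_coe_of_le_coe hlt.le
  have : Filter.Tendsto (fun ε : ℝ≥0 => ((C : ℝ) + ε) * ‖∑ k, rankOne ℂ (e k) (w k)‖)
      (nhdsWithin 0 (Set.Ioi 0)) (nhds ((C + (0 : ℝ≥0)) * ‖∑ k, rankOne ℂ (e k) (w k)‖)) := by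
    refine Filter.Tendsto.mono_left (Continuous.tendsto ?_ 0) nhdsWithin_le_nhds
    fun_prop
  simp only [NNReal.coe_zero, add_zero] at this
  exact ge_of_tendsto this (by filter_upwards [self_mem_nhdsWithin] with ε hε using key ε hε)

/-- A finite sum has countable support, which embeds into `ℕ` with zeros elsewhere. Arbitrary index
sets are needed for Hilbert bases of nonseparable spaces. -/
theorem traceNorm_le_of_hasSum {A : E →L[ℂ] F} {ι : Type*} {u : ι → F} {v : ι → E}
    (h : ∀ x : E, HasSum (fun n => inner ℂ (v n) x • u n) (A x)) :
    traceNorm A ≤ ∑' n, ‖u n‖ₑ * ‖v n‖ₑ := by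
  by_cases hs : ∑' n, ‖u n‖ₑ * ‖v n‖ₑ = ∞
  · simp [hs]
  have hc := Summable.countable_support_ennreal hs
  set J := Function.support fun n => ‖u n‖ₑ * ‖v n‖ₑ with hJ
  have : Countable J := hc
  obtain ⟨f, hf⟩ := exists_injective_nat J
  set u' : ℕ → F := Function.extend f (fun j => u j) 0
  set v' : ℕ → E := Function.extend f (fun j => v j) 0
  have hu' : ∀ j, u' (f j) = u j := fun j => hf.extend_apply _ _ _
  have hv' : ∀ j, v' (f j) = v j := fun j => hf.extend_apply _ _ _
  have hu0 : ∀ m, m ∉ Set.range f → u' m = 0 := fun m hm => by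
    simp only [u']; rw [Function.extend_apply' _ _ _ (by simpa using hm)]; rfl
  have hsum : ∀ x : E, HasSum (fun n => inner ℂ (v' n) x • u' n) (A x) := by
    intro x
    rw [← hf.hasSum_iff]
    · simp only [Function.comp_def, hu', hv']
      refine (hasSum_subtype_iff_of_support_subset
        (f := fun n => inner ℂ (v n) x • u n) (s := J) ?_).2 (h x)
      intro n hn
      simp only [Function.mem_support, hJ] at hn ⊢
      contrapose! hn
      rcases mul_eq_zero.1 hn with h0 | h0 <;> simp_all
    · intro m hm
      simp [hu0 m hm]
  refine (iInf₂_le_of_le u' v' (iInf_le _ hsum)).trans ?_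
  rw [← hf.tsum_eq (f := fun n => ‖u' n‖ₑ * ‖v' n‖ₑ)]
  · simp only [hu', hv']
    exact ENNReal.tsum_comp_le_tsum_of_injective Subtype.val_injective
      (fun n => ‖u n‖ₑ * ‖v n‖ₑ)
  · intro m hm
    by_contra h0
    simp [hu0 m h0] at hm

/-- The map `A x ↦ B x` is a well defined contraction on the range of `A`; it extends to the closure
and is then composed with the orthogonal projection. This supplies the factors of the polar
decomposition. -/
theorem exists_contraction_comp_eq {G : Type*} [NormedAddCommGroup G] [InnerProductSpace ℂ G]
    [CompleteSpace F] [CompleteSpace G] {A : E →L[ℂ] F} {B : E →L[ℂ] G} (h : ∀ x, ‖B x‖ ≤ ‖A x‖) :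
    ∃ W : F →L[ℂ] G, ‖W‖ ≤ 1 ∧ ∀ x, W (A x) = B x := by
  set V : Submodule ℂ F := A.range.topologicalClosure with hV
  have : CompleteSpace V := (Submodule.isClosed_topologicalClosure _).completeSpace_coe
  have hmem : ∀ x, A x ∈ V := fun x => Submodule.le_topologicalClosure _ ⟨x, rfl⟩
  set a : E →ₗ[ℂ] V := A.toLinearMap.codRestrict V hmem
  have ha : DenseRange a := by
    intro y
    rw [Metric.mem_closure_iff]
    intro ε hε
    obtain ⟨z, hz, hd⟩ := Metric.mem_closure_iff.1 (show (y : F) ∈ closure (A.range : Set F) from y.2) ε hε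
    obtain ⟨x, rfl⟩ := hz
    exact ⟨a x, ⟨x, rfl⟩, hd⟩
  have hn : ∀ x, ‖B.toLinearMap x‖ ≤ 1 * ‖a x‖ := fun x => by
    rw [one_mul]; exact h x
  refine ⟨(B.toLinearMap.extendOfNorm a).comp V.orthogonalProjectionOnto, ?_, fun x => ?_⟩
  · refine (ContinuousLinearMap.opNorm_comp_le _ _).trans ?_
    exact mul_le_one₀ (LinearMap.opNorm_extendOfNorm_le ha zero_le_one hn) (norm_nonneg _)
      (Submodule.orthogonalProjectionOnto_norm_le _)
  · have : V.orthogonalProjectionOnto (A x) = a x :=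
      Submodule.orthogonalProjectionOnto_mem_subspace_eq_self (a x)
    rw [ContinuousLinearMap.comp_apply, this]
    exact LinearMap.extendOfNorm_eq ha ⟨1, hn⟩ x

theorem norm_sum_rankOne_self_le {ι : Type*} [Fintype ι] {e : ι → E} (he : Orthonormal ℂ e) :
    ‖∑ k, rankOne ℂ (e k) (e k)‖ ≤ 1 := by
  refine ContinuousLinearMap.opNorm_le_bound _ zero_le_one fun x => ?_
  rw [one_mul]
  refine (sq_le_sq₀ (norm_nonneg _) (norm_nonneg _)).1 ?_
  simp only [_root_.sum_apply, rankOne_apply]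
  have h1 := he.inner_sum (fun k => inner ℂ (e k) x) (fun k => inner ℂ (e k) x) Finset.univ
  have h2 : ‖∑ k, inner ℂ (e k) x • e k‖ ^ 2 = ∑ k, ‖inner ℂ (e k) x‖ ^ 2 := by
    have := @norm_sq_eq_re_inner ℂ _ _ _ _ (∑ k, inner ℂ (e k) x • e k)
    rw [this, h1]
    simp only [Complex.conj_mul']
    norm_cast
  rw [h2]
  exact he.sum_inner_products_le x

/-- With `Q = |A|` and `R` its square root, write `A = W Q` and `Q = V A` for contractions `W`, `V`.
The pairing bound controls the trace `∑ ‖R (b i)‖ ^ 2` of `|A|` over a Hilbert basis, and `A = W R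
R` is then an explicit nuclear series. No compactness of `A` is needed. -/
theorem PairingBound.traceNorm_le [CompleteSpace E] [CompleteSpace F] {A : E →L[ℂ] F} {C : ℝ}
    (hC : 0 ≤ C) (hA : PairingBound A C) : traceNorm A ≤ ENNReal.ofReal C := by
  set P : E →L[ℂ] E := A.adjoint.comp A with hP
  have hP0 : 0 ≤ P := (ContinuousLinearMap.nonneg_iff_isPositive _).2
    (ContinuousLinearMap.isPositive_adjoint_comp_self A)
  set Q := CFC.sqrt P
  have hQ0 : 0 ≤ Q := CFC.sqrt_nonneg P
  set R := CFC.sqrt Q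
  have hR0 : 0 ≤ R := CFC.sqrt_nonneg Q
  have hQQ : Q * Q = P := CFC.sqrt_mul_sqrt_self P hP0
  have hRR : R * R = Q := CFC.sqrt_mul_sqrt_self Q hQ0
  have hQs : ∀ x y, inner ℂ (Q x) y = inner ℂ x (Q y) :=
    ((ContinuousLinearMap.nonneg_iff_isPositive _).1 hQ0).isSymmetric
  have hRs : ∀ x y, inner ℂ (R x) y = inner ℂ x (R y) :=
    ((ContinuousLinearMap.nonneg_iff_isPositive _).1 hR0).isSymmetric
  have hRRa : ∀ x, R (R x) = Q x := fun x => by rw [← hRR]; rfl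
  have hnorm : ∀ x, ‖Q x‖ = ‖A x‖ := by
    intro x
    have h1 : inner ℂ (Q x) (Q x) = inner ℂ (A x) (A x) := by
      rw [hQs, show Q (Q x) = P x by rw [← hQQ]; rfl, hP, ContinuousLinearMap.comp_apply,
        ContinuousLinearMap.adjoint_inner_right]
    rw [inner_self_eq_norm_sq_to_K, inner_self_eq_norm_sq_to_K] at h1
    have h2 : ‖Q x‖ ^ 2 = ‖A x‖ ^ 2 := by exact_mod_cast h1
    exact (sq_eq_sq₀ (norm_nonneg _) (norm_nonneg _)).1 h2
  obtain ⟨W, hW, hWQ⟩ := exists_contraction_comp_eq (A := Q) (B := A) fun x => (hnorm x).ge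
  obtain ⟨V, hV, hVA⟩ := exists_contraction_comp_eq (A := A) (B := Q) fun x => (hnorm x).le
  obtain ⟨ws, b, hb⟩ := exists_hilbertBasis ℂ E
  -- The test operator is `V` followed by the projection onto the span of finitely many basis
  -- vectors; its norm is at most one, and its pairing with `A` is a partial trace of `V A = Q`.
  have hfin : ∀ s : Finset ws, ∑ i ∈ s, ‖R (b i)‖ ^ 2 ≤ C := by
    intro s
    have ho : Orthonormal ℂ (fun i : s => b i) := b.orthonormal.comp _ Subtype.val_injective
    have h1 := hA.fintype (fun i : s => V.adjoint (b i)) (fun i => b i)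
    have h2 : ‖∑ k : s, rankOne ℂ (b k) (V.adjoint (b k))‖ ≤ 1 := by
      have : ∑ k : s, rankOne ℂ (b k) (V.adjoint (b k)) =
          (∑ k : s, rankOne ℂ (b k) (b k)).comp V := by
        ext x
        simp [ContinuousLinearMap.adjoint_inner_left]
      rw [this]
      exact (ContinuousLinearMap.opNorm_comp_le _ _).trans
        (mul_le_one₀ (norm_sum_rankOne_self_le ho) (norm_nonneg _) hV)
    have h3 : ∑ k : s, inner ℂ (V.adjoint (b k)) (A (b k)) = ((∑ i ∈ s, ‖R (b i)‖ ^ 2 : ℝ) : ℂ) := by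
      rw [← Finset.sum_coe_sort s]
      push_cast
      refine Finset.sum_congr rfl fun k _ => ?_
      rw [ContinuousLinearMap.adjoint_inner_left, hVA, ← hRRa, ← hRs, inner_self_eq_norm_sq_to_K]
      rfl
    rw [h3, Complex.norm_real, Real.norm_of_nonneg (by positivity)] at h1
    exact h1.trans (mul_le_of_le_one_right hC h2)
  -- Apply `W R` to the expansion of `R x` in the basis `b`.
  have hsum : ∀ x, HasSum (fun i => inner ℂ (R (b i)) x • W (R (b i))) (A x) := by
    intro x
    have h1 := (b.hasSum_repr (R x)).mapL (W.comp R)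
    rw [ContinuousLinearMap.comp_apply, hRRa, hWQ] at h1
    convert h1 using 2 with i
    rw [map_smul, b.repr_apply_apply, hRs]
    rfl
  refine (traceNorm_le_of_hasSum hsum).trans ?_
  rw [ENNReal.tsum_eq_iSup_sum]
  refine iSup_le fun s => ?_
  have : ∀ i ∈ s, ‖W (R (b i))‖ₑ * ‖R (b i)‖ₑ ≤ ENNReal.ofReal (‖R (b i)‖ ^ 2) := by
    intro i _
    rw [← ofReal_norm, ← ofReal_norm, ← ENNReal.ofReal_mul (norm_nonneg _), sq]
    gcongr
    exact (W.le_opNorm _).trans (mul_le_of_le_one_left (norm_nonneg _) hW)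
  refine (Finset.sum_le_sum this).trans ?_
  rw [← ENNReal.ofReal_sum_of_nonneg (fun _ _ => by positivity)]
  exact ENNReal.ofReal_le_ofReal (hfin s)

end TraceDuality

/-! ### Product kernels and the tensor form of the multiplier bound. -/

section Kernels

set_option linter.unusedSectionVars false

open InnerProductSpace ComplexConjugate

variable {S T : Type*} [MeasurableSpace S] [MeasurableSpace T]
  {μ : Measure S} {ν : Measure T} [SigmaFinite μ] [SigmaFinite ν]

theorem eLpNorm_tensor {f : S → ℂ} {g : T → ℂ} (hf : AEStronglyMeasurable f μ)
    (hg : AEStronglyMeasurable g ν) :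
    eLpNorm (fun z : S × T => f z.1 * g z.2) 2 (μ.prod ν) = eLpNorm f 2 μ * eLpNorm g 2 ν := by
  simp only [eLpNorm_eq_lintegral_rpow_enorm_toReal (p := 2) (by norm_num) (by norm_num),
    ENNReal.toReal_ofNat, enorm_mul, ENNReal.mul_rpow_of_nonneg _ _ (zero_le_two (α := ℝ))]
  rw [lintegral_prod_mul (hf.enorm.pow_const _) (hg.enorm.pow_const _),
    ENNReal.mul_rpow_of_nonneg _ _ (by norm_num)]

theorem memLp_tensor {f : S → ℂ} {g : T → ℂ} (hf : MemLp f 2 μ) (hg : MemLp g 2 ν) :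
    MemLp (fun z : S × T => f z.1 * g z.2) 2 (μ.prod ν) :=
  ⟨hf.1.comp_fst.mul hg.1.comp_snd, by
    rw [eLpNorm_tensor hf.1 hg.1]; exact ENNReal.mul_lt_top hf.2 hg.2⟩

theorem memLp_conj_tensor (w : Lp ℂ 2 μ) (e : Lp ℂ 2 ν) :
    MemLp (fun z : S × T => conj (w z.1) * e z.2) 2 (μ.prod ν) :=
  memLp_tensor (f := fun s => conj (w s)) (Lp.memLp w).star (Lp.memLp e)

theorem integrable_kernel_mul {k : S × T → ℂ} (hk : MemLp k 2 (μ.prod ν)) (w : Lp ℂ 2 μ)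
    (e : Lp ℂ 2 ν) :
    Integrable (fun z : S × T => k z * (conj (w z.1) * e z.2)) (μ.prod ν) :=
  hk.integrable_mul (memLp_conj_tensor w e)

theorem inner_integralOperator {k : S × T → ℂ} (hk : MemLp k 2 (μ.prod ν)) (w : Lp ℂ 2 μ)
    (e : Lp ℂ 2 ν) :
    inner ℂ w (integralOperator k hk e) =
      ∫ z, k z * (conj (w z.1) * e z.2) ∂(μ.prod ν) := by
  rw [L2.inner_def, integral_prod _ (integrable_kernel_mul hk w e)]
  refine integral_congr_ae ?_
  filter_upwards [integralOperator_ae_eq k hk e] with s hs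
  rw [hs, RCLike.inner_apply, mul_comm, ← integral_const_mul]
  refine integral_congr_ae (.of_forall fun t => ?_)
  simp only
  ring

theorem integralOperator_congr {h k : S × T → ℂ} (hh : MemLp h 2 (μ.prod ν))
    (hk : MemLp k 2 (μ.prod ν)) (e : h =ᵐ[μ.prod ν] k) :
    integralOperator h hh = integralOperator k hk := by
  ext1 f
  refine ext_inner_left ℂ fun w => ?_
  rw [inner_integralOperator, inner_integralOperator]
  refine integral_congr_ae ?_
  filter_upwards [e] with z hz
  rw [hz]

theorem integralOperator_tensor (f : Lp ℂ 2 μ) (g : Lp ℂ 2 ν) (x : Lp ℂ 2 ν) :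
    integralOperator (fun z : S × T => f z.1 * g z.2) (memLp_tensor (Lp.memLp f) (Lp.memLp g)) x =
      inner ℂ (star g) x • f := by
  refine ext_inner_left ℂ fun w => ?_
  rw [inner_integralOperator, inner_smul_right, L2.inner_def, L2.inner_def]
  have : ∀ z : S × T, f z.1 * g z.2 * (conj (w z.1) * x z.2) =
      (f z.1 * conj (w z.1)) * (g z.2 * x z.2) := fun z => by ring
  simp only [this]
  rw [integral_prod_mul (fun s => f s * conj (w s)) (fun t => g t * x t), mul_comm]
  congr 1
  refine integral_congr_ae ?_
  filter_upwards [Lp.coeFn_star g] with t ht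
  rw [ht, RCLike.inner_apply, mul_comm]
  simp

theorem kernelTraceNorm_tensor_le (f : Lp ℂ 2 μ) (g : Lp ℂ 2 ν) :
    kernelTraceNorm μ ν (fun z : S × T => f z.1 * g z.2) ≤ ‖f‖ₑ * ‖g‖ₑ := by
  rw [kernelTraceNorm, dif_pos (memLp_tensor (Lp.memLp f) (Lp.memLp g))]
  refine (traceNorm_le_of_hasSum (ι := Unit) (u := fun _ => f) (v := fun _ => star g)
    fun x => ?_).trans ?_
  · rw [integralOperator_tensor]
    exact hasSum_unique _
  · have : ‖star g‖ = ‖g‖ := by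
      rw [Lp.norm_def, Lp.norm_def, eLpNorm_congr_norm_ae (g := g)]
      filter_upwards [Lp.coeFn_star g] with t ht
      rw [ht, Pi.star_apply, norm_star]
    simp [← ofReal_norm, this]

variable (μ ν) in
/-- The bound on the trace pairing of the operators with kernel `Φ (f ⊗ g)` which expresses that
their trace norm is at most `c ‖f‖ ‖g‖`. -/
def TensorFormBound (Φ : S × T → ℂ) (c : ℝ) : Prop :=
  ∀ (f : Lp ℂ 2 μ) (g : Lp ℂ 2 ν) (n : ℕ) (w : Fin n → Lp ℂ 2 μ) (e : Fin n → Lp ℂ 2 ν),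
    ‖∑ k, ∫ z, Φ z * (f z.1 * g z.2) * (conj (w k z.1) * e k z.2) ∂(μ.prod ν)‖ ≤
      c * ‖f‖ * ‖g‖ * ‖∑ k, rankOne ℂ (e k) (w k)‖

theorem tensorFormBound_of_kernelTraceNorm_le {Φ : S × T → ℂ} {c : ℝ≥0}
    (h : ∀ h : S × T → ℂ, MemLp h 2 (μ.prod ν) →
      kernelTraceNorm μ ν (fun z => Φ z * h z) ≤ c * kernelTraceNorm μ ν h) :
    TensorFormBound μ ν Φ c := by
  intro f g n w e
  have h1 := (h _ (memLp_tensor (Lp.memLp f) (Lp.memLp g))).trans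
    (mul_le_mul_right (kernelTraceNorm_tensor_le f g) _)
  -- If the product were not square integrable, the left side of `h1` would be infinite while the
  -- right side is finite.
  have hm : MemLp (fun z : S × T => Φ z * (f z.1 * g z.2)) 2 (μ.prod ν) := by
    by_contra hm
    rw [kernelTraceNorm, dif_neg hm, top_le_iff] at h1
    exact absurd h1 (by finiteness)
  rw [kernelTraceNorm, dif_pos hm] at h1
  have h2 := pairingBound_of_traceNorm_le (C := c * (‖f‖₊ * ‖g‖₊)) (by push_cast; exact h1) n w e
  simp only [inner_integralOperator] at h2
  refine h2.trans_eq ?_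
  push_cast
  ring

end Kernels

/-! ### Averaging over finite partitions. -/

section CellAverages

variable {Ω : Type*} [MeasurableSpace Ω] {P : Measure Ω}

/-- The average of `k - c` is at most the average of `|k - c|`, so replacing `c` by the mean at most
doubles the `L¹` error. -/
theorem setIntegral_norm_setAverage_sub_le [IsFiniteMeasure P] {k : Ω → ℂ} (hk : Integrable k P)
    (C : Set Ω) (c : ℂ) :
    ∫ x in C, ‖(⨍ y in C, k y ∂P) - k x‖ ∂P ≤ 2 * ∫ x in C, ‖k x - c‖ ∂P := by
  have hkc : Integrable (fun x => k x - c) (P.restrict C) := hk.restrict.sub (integrable_const c)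
  by_cases h0 : P C = 0
  · simp [Measure.restrict_eq_zero.2 h0]
  have h1 : P.real C ≠ 0 := by simp [Measure.real, h0, ENNReal.toReal_eq_zero_iff]
  have h2 : (⨍ y in C, k y ∂P) - c = ⨍ y in C, (k y - c) ∂P := by
    rw [setAverage_eq, setAverage_eq, integral_sub hk.restrict (integrable_const c), smul_sub]
    simp [h1]
  have h3 : P.real C * ‖(⨍ y in C, k y ∂P) - c‖ ≤ ∫ x in C, ‖k x - c‖ ∂P := by
    rw [h2, setAverage_eq, norm_smul, norm_inv, Real.norm_of_nonneg measureReal_nonneg,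
      mul_inv_cancel_left₀ h1]
    exact norm_integral_le_integral_norm _
  calc ∫ x in C, ‖(⨍ y in C, k y ∂P) - k x‖ ∂P
      ≤ ∫ x in C, (‖(⨍ y in C, k y ∂P) - c‖ + ‖k x - c‖) ∂P := by
        refine integral_mono ((integrable_const _).sub hk.restrict).norm
          ((integrable_const _).add hkc.norm) fun x => ?_
        rw [norm_sub_rev (k x) c]
        exact norm_sub_le_norm_sub_add_norm_sub _ _ _
    _ = P.real C * ‖(⨍ y in C, k y ∂P) - c‖ + ∫ x in C, ‖k x - c‖ ∂P := by
        rw [integral_add (integrable_const _) hkc.norm]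
        simp
    _ ≤ _ := by linarith

theorem integral_eq_sum_setIntegral_preimage {ι : Type*} [Fintype ι] {θ : Ω → ι}
    (hθ : ∀ i, MeasurableSet (θ ⁻¹' {i})) {E : Type*} [NormedAddCommGroup E] [NormedSpace ℝ E]
    {f : Ω → E} (hf : Integrable f P) :
    ∫ x, f x ∂P = ∑ i, ∫ x in θ ⁻¹' {i}, f x ∂P := by
  rw [← integral_iUnion_fintype hθ _ fun i => hf.integrableOn]
  · rw [← Set.preimage_iUnion, Set.iUnion_of_singleton, Set.preimage_univ, Measure.restrict_univ]
  · intro i j hij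
    exact Disjoint.preimage _ (by simpa using hij)

theorem measurable_comp_of_preimage_singleton {ι : Type*} [Finite ι] {θ : Ω → ι}
    (hθ : ∀ i, MeasurableSet (θ ⁻¹' {i})) {E : Type*} [MeasurableSpace E] (c : ι → E) :
    Measurable fun x => c (θ x) := by
  let _ : MeasurableSpace ι := ⊤
  have : Measurable θ := measurable_to_countable' hθ
  exact measurable_from_top.comp this

theorem integrable_comp_of_preimage_singleton [IsFiniteMeasure P] {ι : Type*} [Finite ι] {θ : Ω → ι}
    (hθ : ∀ i, MeasurableSet (θ ⁻¹' {i})) (c : ι → ℂ) : Integrable (fun x => c (θ x)) P := by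
  cases nonempty_fintype ι
  refine Integrable.of_bound
    (measurable_comp_of_preimage_singleton hθ c).aestronglyMeasurable (∑ i, ‖c i‖)
    (.of_forall fun x => ?_)
  exact Finset.single_le_sum (f := fun i => ‖c i‖) (fun i _ => norm_nonneg _) (Finset.mem_univ _)

theorem integral_norm_cellAverage_sub_le [IsFiniteMeasure P] {ι : Type*} [Finite ι] {θ : Ω → ι}
    (hθ : ∀ i, MeasurableSet (θ ⁻¹' {i})) {k : Ω → ℂ} (hk : Integrable k P) (c : ι → ℂ) :
    ∫ x, ‖(⨍ y in θ ⁻¹' {θ x}, k y ∂P) - k x‖ ∂P ≤ 2 * ∫ x, ‖k x - c (θ x)‖ ∂P := by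
  cases nonempty_fintype ι
  rw [integral_eq_sum_setIntegral_preimage hθ, integral_eq_sum_setIntegral_preimage hθ,
    Finset.mul_sum]
  · refine Finset.sum_le_sum fun i _ => ?_
    refine le_trans (le_of_eq ?_) ((setIntegral_norm_setAverage_sub_le hk (θ ⁻¹' {i}) (c i)).trans
      (le_of_eq ?_))
    · refine setIntegral_congr_fun (hθ i) fun x hx => ?_
      rw [Set.mem_preimage, Set.mem_singleton_iff] at hx
      simp only [hx]
    · congr 1
      refine setIntegral_congr_fun (hθ i) fun x hx => ?_
      rw [Set.mem_preimage, Set.mem_singleton_iff] at hx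
      simp only [hx]
  · exact (hk.sub (integrable_comp_of_preimage_singleton hθ c)).norm
  · exact ((integrable_comp_of_preimage_singleton hθ
      (fun i => ⨍ y in θ ⁻¹' {i}, k y ∂P)).sub hk).norm

end CellAverages

/-! ### Approximation in `L¹` by averages over grids of measurable rectangles. -/

section RectangleApproximation

set_option linter.unusedSectionVars false

variable {S T : Type*} [MeasurableSpace S] [MeasurableSpace T]

/-- The sets which are unions of cells of a finite grid of measurable rectangles. -/
def gridSets (S T : Type*) [MeasurableSpace S] [MeasurableSpace T] : Set (Set (S × T)) :=
  {E | ∃ (ι κ : Type) (_ : Finite ι) (_ : Finite κ) (τ : S → ι) (σ : T → κ) (D : Set (ι × κ)),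
    (∀ i, MeasurableSet (τ ⁻¹' {i})) ∧ (∀ j, MeasurableSet (σ ⁻¹' {j})) ∧
      E = Prod.map τ σ ⁻¹' D}

theorem measurableSet_preimage_prodMk {Ω ι κ : Type*} [MeasurableSpace Ω] {τ : Ω → ι} {σ : Ω → κ}
    (hτ : ∀ i, MeasurableSet (τ ⁻¹' {i})) (hσ : ∀ j, MeasurableSet (σ ⁻¹' {j})) (p : ι × κ) :
    MeasurableSet ((fun x => (τ x, σ x)) ⁻¹' {p}) := by
  convert (hτ p.1).inter (hσ p.2) using 1
  ext x
  simp [Prod.ext_iff]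

theorem preimage_prodMap_singleton {ι κ : Type*} (τ : S → ι) (σ : T → κ) (p : ι × κ) :
    Prod.map τ σ ⁻¹' {p} = (τ ⁻¹' {p.1}) ×ˢ (σ ⁻¹' {p.2}) := by
  ext x
  simp [Prod.ext_iff]

theorem measurableSet_preimage_prodMap {ι κ : Type*} {τ : S → ι} {σ : T → κ}
    (hτ : ∀ i, MeasurableSet (τ ⁻¹' {i})) (hσ : ∀ j, MeasurableSet (σ ⁻¹' {j})) (p : ι × κ) :
    MeasurableSet (Prod.map τ σ ⁻¹' {p}) := by
  rw [preimage_prodMap_singleton]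
  exact (hτ p.1).prod (hσ p.2)

theorem isSetRing_gridSets : IsSetRing (gridSets S T) where
  empty_mem := ⟨Unit, Unit, inferInstance, inferInstance, fun _ => (), fun _ => (), ∅,
    by simp, by simp, by simp⟩
  union_mem := by
    rintro _ _ ⟨ι, κ, _, _, τ, σ, D, hτ, hσ, rfl⟩ ⟨ι', κ', _, _, τ', σ', D', hτ', hσ', rfl⟩
    exact ⟨ι × ι', κ × κ', inferInstance, inferInstance, fun s => (τ s, τ' s), fun t => (σ t, σ' t),
      {p | (p.1.1, p.2.1) ∈ D ∨ (p.1.2, p.2.2) ∈ D'}, measurableSet_preimage_prodMk hτ hτ',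
      measurableSet_preimage_prodMk hσ hσ', rfl⟩
  sdiff_mem := by
    rintro _ _ ⟨ι, κ, _, _, τ, σ, D, hτ, hσ, rfl⟩ ⟨ι', κ', _, _, τ', σ', D', hτ', hσ', rfl⟩
    exact ⟨ι × ι', κ × κ', inferInstance, inferInstance, fun s => (τ s, τ' s), fun t => (σ t, σ' t),
      {p | (p.1.1, p.2.1) ∈ D ∧ (p.1.2, p.2.2) ∉ D'}, measurableSet_preimage_prodMk hτ hτ',
      measurableSet_preimage_prodMk hσ hσ', rfl⟩

theorem measurableSet_preimage_mem {Ω : Type*} [MeasurableSpace Ω] {A : Set Ω}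
    (hA : MeasurableSet A) (p : Prop) : MeasurableSet ((fun x => x ∈ A) ⁻¹' {p}) := by
  by_cases hp : p
  · convert hA using 1
    ext x; simp [hp]
  · convert hA.compl using 1
    ext x; simp [hp]

theorem generateFrom_gridSets :
    (inferInstance : MeasurableSpace (S × T)) = MeasurableSpace.generateFrom (gridSets S T) := by
  refine le_antisymm ?_ (MeasurableSpace.generateFrom_le ?_)
  · rw [← generateFrom_prod]
    refine MeasurableSpace.generateFrom_mono ?_
    rintro _ ⟨A, hA, B, hB, rfl⟩
    exact ⟨Prop, Prop, inferInstance, inferInstance, fun s => s ∈ A, fun t => t ∈ B,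
      {p | p.1 ∧ p.2}, measurableSet_preimage_mem hA, measurableSet_preimage_mem hB, rfl⟩
  · rintro _ ⟨ι, κ, _, _, τ, σ, D, hτ, hσ, rfl⟩
    rw [← Set.biUnion_preimage_singleton]
    exact MeasurableSet.biUnion D.to_countable fun p _ => measurableSet_preimage_prodMap hτ hσ p

variable {μ : Measure S} {ν : Measure T} [IsFiniteMeasure μ] [IsFiniteMeasure ν]

/-- Grid sets form a ring generating the product σ-algebra, so they approximate measurable sets in
measure; this settles indicators. Sums pass to the common refinement of two grids, and limits are
absorbed in `ε / 2`. -/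
theorem exists_grid_integral_norm_sub_lt {k : S × T → ℂ} (hk : Integrable k (μ.prod ν)) :
    ∀ ε : ℝ, 0 < ε → ∃ (ι κ : Type) (_ : Finite ι) (_ : Finite κ) (τ : S → ι) (σ : T → κ)
      (c : ι × κ → ℂ), (∀ i, MeasurableSet (τ ⁻¹' {i})) ∧ (∀ j, MeasurableSet (σ ⁻¹' {j})) ∧
        ∫ z, ‖k z - c (Prod.map τ σ z)‖ ∂(μ.prod ν) < ε := by
  classical
  refine Integrable.induction (P := fun k => ∀ ε : ℝ, 0 < ε → ∃ (ι κ : Type) (_ : Finite ι)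
    (_ : Finite κ) (τ : S → ι) (σ : T → κ) (c : ι × κ → ℂ), (∀ i, MeasurableSet (τ ⁻¹' {i})) ∧
    (∀ j, MeasurableSet (σ ⁻¹' {j})) ∧ ∫ z, ‖k z - c (Prod.map τ σ z)‖ ∂(μ.prod ν) < ε)
    ?_ ?_ ?_ ?_ hk
  · intro c s hs _ ε hε
    -- The added `1` covers `c = 0`.
    have hδ : 0 < ε / (‖c‖ + 1) := by positivity
    obtain ⟨_, ⟨ι, κ, hι, hκ, τ, σ, D, hτ, hσ, rfl⟩, hlt⟩ :=
      exists_measure_symmDiff_lt_of_generateFrom_isSetRing (μ := μ.prod ν) isSetRing_gridSets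
        ⟨{Set.univ}, by simp, Set.singleton_subset_iff.2 ⟨Unit, Unit, inferInstance, inferInstance,
          fun _ => (), fun _ => (), Set.univ, by simp, by simp, by simp⟩, by simp⟩
        generateFrom_gridSets hs (ENNReal.ofReal_pos.2 hδ)
    refine ⟨ι, κ, hι, hκ, τ, σ, D.indicator fun _ => c, hτ, hσ, ?_⟩
    set E := Prod.map τ σ ⁻¹' D with hE
    have hEm : MeasurableSet E := by
      rw [hE, ← Set.biUnion_preimage_singleton]
      exact MeasurableSet.biUnion D.to_countable fun p _ => measurableSet_preimage_prodMap hτ hσ p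
    have h1 : ∀ z, ‖s.indicator (fun _ => c) z - D.indicator (fun _ => c) (Prod.map τ σ z)‖ =
        (symmDiff E s).indicator (fun _ => ‖c‖) z := by
      intro z
      have : (Prod.map τ σ z ∈ D) = (z ∈ E) := rfl
      simp only [Set.indicator, Set.mem_symmDiff, this]
      by_cases h1 : z ∈ E <;> by_cases h2 : z ∈ s <;> simp [h1, h2]
    simp_rw [h1]
    rw [integral_indicator (hEm.symmDiff hs), setIntegral_const, smul_eq_mul]
    have h2 : (μ.prod ν).real (symmDiff E s) < ε / (‖c‖ + 1) :=
      (ENNReal.lt_ofReal_iff_toReal_lt (measure_ne_top _ _)).1 hlt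
    calc _ ≤ ε / (‖c‖ + 1) * ‖c‖ := by gcongr
      _ < ε / (‖c‖ + 1) * (‖c‖ + 1) := by gcongr; linarith
      _ = ε := by field_simp
  · intro f g _ hf hg hPf hPg ε hε
    obtain ⟨ι, κ, _, _, τ, σ, c, hτ, hσ, h1⟩ := hPf (ε / 2) (half_pos hε)
    obtain ⟨ι', κ', _, _, τ', σ', c', hτ', hσ', h2⟩ := hPg (ε / 2) (half_pos hε)
    refine ⟨ι × ι', κ × κ', inferInstance, inferInstance, fun s => (τ s, τ' s),
      fun t => (σ t, σ' t), fun p => c (p.1.1, p.2.1) + c' (p.1.2, p.2.2),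
      measurableSet_preimage_prodMk hτ hτ', measurableSet_preimage_prodMk hσ hσ', ?_⟩
    have i1 := (hf.sub (integrable_comp_of_preimage_singleton
      (measurableSet_preimage_prodMap hτ hσ) c)).norm
    have i2 := (hg.sub (integrable_comp_of_preimage_singleton
      (measurableSet_preimage_prodMap hτ' hσ') c')).norm
    refine lt_of_le_of_lt (integral_mono_of_nonneg (.of_forall fun z => norm_nonneg _)
      (i1.add i2) (.of_forall fun z => ?_)) ?_
    · simp only [Pi.add_apply, Pi.sub_apply]
      rw [add_sub_add_comm]
      exact norm_add_le _ _
    · rw [integral_add' i1 i2]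
      simp only [Pi.sub_apply]
      linarith
  · refine isClosed_of_closure_subset fun f hf ε hε => ?_
    obtain ⟨g, hg, hd⟩ := Metric.mem_closure_iff.1 hf (ε / 2) (half_pos hε)
    obtain ⟨ι, κ, hι, hκ, τ, σ, c, hτ, hσ, h1⟩ := hg (ε / 2) (half_pos hε)
    refine ⟨ι, κ, hι, hκ, τ, σ, c, hτ, hσ, ?_⟩
    rw [L1.dist_eq_integral_dist] at hd
    have ic := integrable_comp_of_preimage_singleton (P := μ.prod ν)
      (measurableSet_preimage_prodMap hτ hσ) c
    have i1 := ((L1.integrable_coeFn f).sub (L1.integrable_coeFn g)).norm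
    have i2 := ((L1.integrable_coeFn g).sub ic).norm
    refine lt_of_le_of_lt (integral_mono_of_nonneg (.of_forall fun z => norm_nonneg _)
      (i1.add i2) (.of_forall fun z => ?_)) ?_
    · simp only [Pi.add_apply, Pi.sub_apply]
      exact norm_sub_le_norm_sub_add_norm_sub _ _ _
    · rw [integral_add' i1 i2]
      simp only [Pi.sub_apply]
      simp only [dist_eq_norm] at hd
      linarith
  · intro f g hfg _ hPf ε hε
    obtain ⟨ι, κ, hι, hκ, τ, σ, c, hτ, hσ, h1⟩ := hPf ε hε
    refine ⟨ι, κ, hι, hκ, τ, σ, c, hτ, hσ, ?_⟩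
    rwa [integral_congr_ae (g := fun z => ‖f z - c (Prod.map τ σ z)‖)]
    filter_upwards [hfg] with z hz
    rw [hz]

theorem exists_cellAverage_integral_norm_sub_lt {k : S × T → ℂ} (hk : Integrable k (μ.prod ν))
    {ε : ℝ} (hε : 0 < ε) : ∃ (ι κ : Type) (_ : Finite ι) (_ : Finite κ) (τ : S → ι) (σ : T → κ),
      (∀ i, MeasurableSet (τ ⁻¹' {i})) ∧ (∀ j, MeasurableSet (σ ⁻¹' {j})) ∧
        ∫ z, ‖(⨍ y in (τ ⁻¹' {τ z.1}) ×ˢ (σ ⁻¹' {σ z.2}), k y ∂(μ.prod ν)) - k z‖ ∂(μ.prod ν)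
          < ε := by
  obtain ⟨ι, κ, hι, hκ, τ, σ, c, hτ, hσ, h1⟩ :=
    exists_grid_integral_norm_sub_lt hk (ε / 2) (half_pos hε)
  refine ⟨ι, κ, hι, hκ, τ, σ, hτ, hσ, ?_⟩
  have := integral_norm_cellAverage_sub_le (measurableSet_preimage_prodMap hτ hσ) hk c
  simp only [preimage_prodMap_singleton, Prod.map_fst, Prod.map_snd] at this
  linarith

/-- Every cell average of `k` vanishes, yet cell averages approximate `k` in `L¹`. -/
theorem ae_eq_zero_of_forall_setIntegral_prod_eq_zero {k : S × T → ℂ}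
    (hk : Integrable k (μ.prod ν)) (h : ∀ A B, MeasurableSet A → MeasurableSet B →
      ∫ z in A ×ˢ B, k z ∂(μ.prod ν) = 0) : k =ᵐ[μ.prod ν] 0 := by
  have h0 : ∫ z, ‖k z‖ ∂(μ.prod ν) ≤ 0 := by
    refine le_of_forall_pos_le_add fun ε hε => ?_
    obtain ⟨ι, κ, _, _, τ, σ, hτ, hσ, h1⟩ := exists_cellAverage_integral_norm_sub_lt hk hε
    simp only [setAverage_eq, h _ _ (hτ _) (hσ _), smul_zero, zero_sub, norm_neg] at h1
    linarith
  have h1 := (integral_eq_zero_iff_of_nonneg (fun z => norm_nonneg _) hk.norm).1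
    (le_antisymm h0 (integral_nonneg fun z => norm_nonneg _))
  filter_upwards [h1] with z hz
  simpa using hz

end RectangleApproximation

/-! ### A finite constant from the uniform boundedness principle. -/

section UniformBoundedness

set_option linter.unusedSectionVars false

open InnerProductSpace ComplexConjugate

variable {S T : Type*} [MeasurableSpace S] [MeasurableSpace T]
  {μ : Measure S} {ν : Measure T} [SigmaFinite μ] [SigmaFinite ν]

theorem IsMeasureSchurMultiplier.memLp {Φ : S × T → ℂ} (hΦ : IsMeasureSchurMultiplier μ ν Φ)
    (f : Lp ℂ 2 μ) (g : Lp ℂ 2 ν) : MemLp (fun z => Φ z * (f z.1 * g z.2)) 2 (μ.prod ν) := by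
  have hm := memLp_tensor (Lp.memLp f) (Lp.memLp g)
  have h1 := kernelTraceNorm_tensor_le f g
  rw [kernelTraceNorm, dif_pos hm] at h1
  exact (hΦ.2 _ hm (h1.trans_lt (by finiteness))).1

theorem exists_pairingBound {Φ : S × T → ℂ} (hΦ : IsMeasureSchurMultiplier μ ν Φ)
    (f : Lp ℂ 2 μ) (g : Lp ℂ 2 ν) :
    ∃ C : ℝ≥0, PairingBound (integralOperator _ (hΦ.memLp f g)) C := by
  have hm := memLp_tensor (Lp.memLp f) (Lp.memLp g)
  have h1 := kernelTraceNorm_tensor_le f g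
  rw [kernelTraceNorm, dif_pos hm] at h1
  obtain ⟨_, h2⟩ := hΦ.2 _ hm (h1.trans_lt (by finiteness))
  exact ⟨(traceNorm (integralOperator _ (hΦ.memLp f g))).toNNReal,
    pairingBound_of_traceNorm_le (ENNReal.coe_toNNReal h2.ne).ge⟩

theorem ae_fst {p : S → Prop} (h : ∀ᵐ s ∂μ, p s) : ∀ᵐ z ∂(μ.prod ν), p z.1 :=
  Measure.quasiMeasurePreserving_fst.ae h

theorem ae_snd {p : T → Prop} (h : ∀ᵐ t ∂ν, p t) : ∀ᵐ z ∂(μ.prod ν), p z.2 :=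
  Measure.quasiMeasurePreserving_snd.ae h

/-- A linear map `V : L²(m) → L²(m')` is continuous if it is a multiplication operator composed with
the pull-back by a quasi measure preserving map. -/
theorem continuous_of_ae_eq_mul {X Y : Type*} [MeasurableSpace X] [MeasurableSpace Y]
    {m : Measure X} {m' : Measure Y} (V : Lp ℂ 2 m →ₗ[ℂ] Lp ℂ 2 m') {φ : Y → ℂ} {π : Y → X}
    (hπ : Measure.QuasiMeasurePreserving π m' m) (hV : ∀ f, V f =ᵐ[m'] fun y => φ y * f (π y)) :
    Continuous V := by
  refine LinearMap.continuous_of_seq_closed_graph V fun u x y hu hy => ?_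
  obtain ⟨a, ha, h1⟩ := (tendstoInMeasure_of_tendsto_Lp hu).exists_seq_tendsto_ae
  obtain ⟨b, hb, h2⟩ := (tendstoInMeasure_of_tendsto_Lp
    (hy.comp ha.tendsto_atTop)).exists_seq_tendsto_ae
  refine Lp.ext ?_
  have h3 : ∀ᵐ z ∂m', ∀ n, V (u n) z = φ z * u n (π z) := ae_all_iff.2 fun n => hV (u n)
  filter_upwards [hπ.ae h1, h2, h3, hV x] with z hz1 hz2 hz3 hz4
  rw [hz4]
  refine tendsto_nhds_unique hz2 ?_
  simp only [Function.comp_apply, hz3]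
  exact (hz1.comp hb.tendsto_atTop).const_mul _

/-- The closed graph theorem gives continuity in `f` for fixed `g`, with no uniformity in `g`;
together with the symmetric statement this is what Banach-Steinhaus requires. -/
theorem exists_continuousLinearMap_left {Φ : S × T → ℂ} (hΦ : IsMeasureSchurMultiplier μ ν Φ)
    (g : Lp ℂ 2 ν) : ∃ V : Lp ℂ 2 μ →L[ℂ] Lp ℂ 2 (μ.prod ν),
      ∀ f, V f =ᵐ[μ.prod ν] fun z => Φ z * (f z.1 * g z.2) := by
  let V : Lp ℂ 2 μ →ₗ[ℂ] Lp ℂ 2 (μ.prod ν) :=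
    { toFun := fun f => (hΦ.memLp f g).toLp
      map_add' := by
        intro f f'
        rw [← MemLp.toLp_add]
        refine MemLp.toLp_congr _ _ ?_
        filter_upwards [ae_fst (ν := ν) (Lp.coeFn_add f f')] with z hz
        rw [hz, Pi.add_apply, Pi.add_apply]
        ring
      map_smul' := by
        intro c f
        rw [RingHom.id_apply, ← MemLp.toLp_const_smul]
        refine MemLp.toLp_congr _ _ ?_
        filter_upwards [ae_fst (ν := ν) (Lp.coeFn_smul c f)] with z hz
        rw [hz, Pi.smul_apply, Pi.smul_apply, smul_eq_mul, smul_eq_mul]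
        ring }
  have hV : ∀ f, V f =ᵐ[μ.prod ν] fun z => Φ z * (f z.1 * g z.2) :=
    fun f => (hΦ.memLp f g).coeFn_toLp
  refine ⟨⟨V, continuous_of_ae_eq_mul V (φ := fun z => Φ z * g z.2)
    Measure.quasiMeasurePreserving_fst fun f => ?_⟩, hV⟩
  filter_upwards [hV f] with z hz
  rw [hz]
  ring

theorem exists_continuousLinearMap_right {Φ : S × T → ℂ} (hΦ : IsMeasureSchurMultiplier μ ν Φ)
    (f : Lp ℂ 2 μ) : ∃ V : Lp ℂ 2 ν →L[ℂ] Lp ℂ 2 (μ.prod ν),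
      ∀ g, V g =ᵐ[μ.prod ν] fun z => Φ z * (f z.1 * g z.2) := by
  let V : Lp ℂ 2 ν →ₗ[ℂ] Lp ℂ 2 (μ.prod ν) :=
    { toFun := fun g => (hΦ.memLp f g).toLp
      map_add' := by
        intro g g'
        rw [← MemLp.toLp_add]
        refine MemLp.toLp_congr _ _ ?_
        filter_upwards [ae_snd (μ := μ) (Lp.coeFn_add g g')] with z hz
        rw [hz, Pi.add_apply, Pi.add_apply]
        ring
      map_smul' := by
        intro c g
        rw [RingHom.id_apply, ← MemLp.toLp_const_smul]
        refine MemLp.toLp_congr _ _ ?_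
        filter_upwards [ae_snd (μ := μ) (Lp.coeFn_smul c g)] with z hz
        rw [hz, Pi.smul_apply, Pi.smul_apply, smul_eq_mul, smul_eq_mul]
        ring }
  have hV : ∀ g, V g =ᵐ[μ.prod ν] fun z => Φ z * (f z.1 * g z.2) :=
    fun g => (hΦ.memLp f g).coeFn_toLp
  refine ⟨⟨V, continuous_of_ae_eq_mul V (φ := fun z => Φ z * f z.1)
    Measure.quasiMeasurePreserving_snd fun g => ?_⟩, hV⟩
  filter_upwards [hV g] with z hz
  rw [hz]
  ring

theorem inner_toLp_conj_conj_tensor (w : Lp ℂ 2 μ) (e : Lp ℂ 2 ν) {k : S × T → ℂ}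
    {K : Lp ℂ 2 (μ.prod ν)} (hK : K =ᵐ[μ.prod ν] k) :
    inner ℂ (star (memLp_conj_tensor w e).toLp) K =
      ∫ z, k z * (conj (w z.1) * e z.2) ∂(μ.prod ν) := by
  rw [L2.inner_def]
  refine integral_congr_ae ?_
  filter_upwards [hK, Lp.coeFn_star (memLp_conj_tensor w e).toLp,
    (memLp_conj_tensor w e).coeFn_toLp] with z h1 h2 h3
  rw [h1, h2, Pi.star_apply, h3, RCLike.inner_apply]
  simp

/-- The functionals `ψ j` are the trace pairings with all finite rank operators, normalized by
operator norm. They are bounded at each `Φ (f ⊗ g)`. Uniform boundedness in `f` for fixed `g`, and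
then in `g` over all `j` and all `f` in the unit ball, gives one constant. -/
theorem exists_tensorFormBound {Φ : S × T → ℂ} (hΦ : IsMeasureSchurMultiplier μ ν Φ) :
    ∃ c : ℝ≥0, TensorFormBound μ ν Φ c := by
  choose L hL using exists_continuousLinearMap_left hΦ
  choose R hR using exists_continuousLinearMap_right hΦ
  let J := Σ n : ℕ, (Fin n → Lp ℂ 2 μ) × (Fin n → Lp ℂ 2 ν)
  let ψ : J → Lp ℂ 2 (μ.prod ν) →L[ℂ] ℂ := fun j =>
    ((‖∑ k, rankOne ℂ (j.2.2 k) (j.2.1 k)‖⁻¹ : ℝ) : ℂ) •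
      ∑ k, innerSL ℂ (star (memLp_conj_tensor (j.2.1 k) (j.2.2 k)).toLp)
  have hψ : ∀ j f g (K : Lp ℂ 2 (μ.prod ν)), K =ᵐ[μ.prod ν] (fun z => Φ z * (f z.1 * g z.2)) →
      ψ j K = ((‖∑ k, rankOne ℂ (j.2.2 k) (j.2.1 k)‖⁻¹ : ℝ) : ℂ) * ∑ k, inner ℂ (j.2.1 k)
        (integralOperator _ (hΦ.memLp f g) (j.2.2 k)) := by
    intro j f g K hK
    simp only [ψ, _root_.smul_apply, _root_.sum_apply, smul_eq_mul, innerSL_apply_apply]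
    congr 1
    refine Finset.sum_congr rfl fun k _ => ?_
    rw [inner_toLp_conj_conj_tensor _ _ hK, inner_integralOperator]
  have hpt : ∀ f g, ∃ C, ∀ j, ‖ψ j (L g f)‖ ≤ C := by
    intro f g
    obtain ⟨C, hC⟩ := exists_pairingBound hΦ f g
    refine ⟨C, fun j => ?_⟩
    rw [hψ j f g _ (hL g f), norm_mul, Complex.norm_real, norm_inv, norm_norm,
      inv_mul_eq_div]
    exact div_le_of_le_mul₀ (norm_nonneg _) (NNReal.coe_nonneg C) (hC _ _ _)
  have hLR : ∀ f g, L g f = R f g := fun f g => Lp.ext ((hL g f).trans (hR f g).symm)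
  have h1 : ∀ g, ∃ C, ∀ j, ‖(ψ j).comp (L g)‖ ≤ C := fun g =>
    banach_steinhaus fun f => hpt f g
  have h2 : ∃ C, ∀ i : J × Metric.closedBall (0 : Lp ℂ 2 μ) 1, ‖(ψ i.1).comp (R i.2)‖ ≤ C := by
    refine banach_steinhaus fun g => ?_
    obtain ⟨C, hC⟩ := h1 g
    refine ⟨C, fun i => ?_⟩
    have hi : ‖(i.2 : Lp ℂ 2 μ)‖ ≤ 1 := mem_closedBall_zero_iff.1 i.2.2
    rw [ContinuousLinearMap.comp_apply, ← hLR]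
    exact (((ψ i.1).comp (L g)).le_of_opNorm_le (hC i.1) _).trans
      (mul_le_of_le_one_right ((norm_nonneg _).trans (hC i.1)) hi)
  obtain ⟨C, hC⟩ := h2
  refine ⟨C.toNNReal, fun f g n w e => ?_⟩
  let j : J := ⟨n, w, e⟩
  set N := ‖∑ k, rankOne ℂ (e k) (w k)‖ with hN
  have hC0 : 0 ≤ (C.toNNReal : ℝ) := NNReal.coe_nonneg _
  have h3 : ‖(ψ j).comp (L g)‖ ≤ C.toNNReal * ‖g‖ := by
    refine ContinuousLinearMap.opNorm_le_of_unit_norm (by positivity) fun f hf => ?_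
    rw [ContinuousLinearMap.comp_apply, hLR]
    exact ((ψ j).comp (R f)).le_of_opNorm_le
      ((hC (j, ⟨f, mem_closedBall_zero_iff.2 hf.le⟩)).trans (Real.le_coe_toNNReal C)) g
  have h4 := ((ψ j).comp (L g)).le_of_opNorm_le h3 f
  rw [ContinuousLinearMap.comp_apply, hψ j f g _ (hL g f), norm_mul, Complex.norm_real, norm_inv,
    norm_norm] at h4
  simp only [j, inner_integralOperator, ← hN] at h4
  obtain ⟨D, hD⟩ := exists_pairingBound hΦ f g
  have h5 := hD n w e
  simp only [inner_integralOperator, ← hN] at h5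
  -- For `N = 0` the functional `ψ j` is zero, because the inverse of `0` is `0`, and says nothing;
  -- the individual bound `h5` shows that the pairing vanishes.
  rcases eq_or_ne N 0 with h0 | h0
  · rw [h0, mul_zero] at h5 ⊢
    exact h5
  · have hNpos : 0 < N := lt_of_le_of_ne (norm_nonneg _) h0.symm
    rw [inv_mul_le_iff₀ hNpos] at h4
    exact h4.trans_eq (by ring)

end UniformBoundedness

/-! ### Matrices of bounded operators and Schur bounds on finite sections. -/

section MatrixOperators

open ComplexConjugate

variable {S T : Type*}

theorem lp_sum_norm_sq_le (x : lp (fun _ : T => ℂ) 2) (G : Finset T) :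
    ∑ t ∈ G, ‖x t‖ ^ 2 ≤ ‖x‖ ^ 2 := by
  have := lp.sum_rpow_le_norm_rpow (p := 2) (by norm_num) x G
  simpa using this

theorem lp_norm_le_of_sum_norm_sq_le {C : ℝ} (hC : 0 ≤ C) (x : lp (fun _ : T => ℂ) 2)
    (h : ∀ G : Finset T, ∑ t ∈ G, ‖x t‖ ^ 2 ≤ C ^ 2) : ‖x‖ ≤ C :=
  lp.norm_le_of_forall_sum_le (p := 2) (by norm_num) hC fun G => by simpa using h G

theorem memlp_of_sum_norm_sq_le {C : ℝ} (x : T → ℂ)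
    (h : ∀ G : Finset T, ∑ t ∈ G, ‖x t‖ ^ 2 ≤ C) : Memℓp x 2 :=
  memℓp_gen' (C := C) fun G => by simpa using h G

open Classical in
/-- The finitely supported vector with coordinates `ξ t`, `t ∈ G`. -/
noncomputable def finsetVector (G : Finset T) (ξ : T → ℂ) : lp (fun _ : T => ℂ) 2 :=
  ∑ t ∈ G, ξ t • lp.single 2 t (1 : ℂ)

theorem finsetVector_apply_of_mem {G : Finset T} {ξ : T → ℂ} {t : T} (ht : t ∈ G) :
    finsetVector G ξ t = ξ t := by
  classical
  simp only [finsetVector, lp.coeFn_sum, Finset.sum_apply, lp.coeFn_smul, Pi.smul_apply,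
    lp.coeFn_single, smul_eq_mul]
  rw [Finset.sum_eq_single t]
  · simp
  · intro t' _ h
    simp [h.symm]
  · exact fun h => absurd ht h

theorem norm_finsetVector_le (G : Finset T) (ξ : T → ℂ) :
    ‖finsetVector G ξ‖ ≤ √(∑ t ∈ G, ‖ξ t‖ ^ 2) := by
  classical
  refine lp_norm_le_of_sum_norm_sq_le (Real.sqrt_nonneg _) _ fun H => ?_
  rw [Real.sq_sqrt (by positivity)]
  have : ∀ t ∉ G, finsetVector G ξ t = 0 := by
    intro t ht
    simp only [finsetVector, lp.coeFn_sum, Finset.sum_apply, lp.coeFn_smul, Pi.smul_apply,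
      lp.coeFn_single, smul_eq_mul]
    refine Finset.sum_eq_zero fun t' ht' => ?_
    have : t ≠ t' := fun h => ht (h ▸ ht')
    simp [this]
  calc ∑ t ∈ H, ‖finsetVector G ξ t‖ ^ 2 ≤ ∑ t ∈ H ∪ G, ‖finsetVector G ξ t‖ ^ 2 :=
        Finset.sum_le_sum_of_subset_of_nonneg Finset.subset_union_left fun _ _ _ => by positivity
    _ = ∑ t ∈ G, ‖finsetVector G ξ t‖ ^ 2 := by
        refine (Finset.sum_subset Finset.subset_union_right fun t _ ht => ?_).symm
        simp [this t ht]
    _ = ∑ t ∈ G, ‖ξ t‖ ^ 2 := Finset.sum_congr rfl fun t ht => by rw [finsetVector_apply_of_mem ht]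
    _ ≤ _ := le_rfl

theorem apply_finsetVector (A : lp (fun _ : T => ℂ) 2 →L[ℂ] lp (fun _ : S => ℂ) 2) (G : Finset T)
    (ξ : T → ℂ) (s : S) :
    A (finsetVector G ξ) s = ∑ t ∈ G, matrixEntry A s t * ξ t := by
  simp only [finsetVector, map_sum, map_smul, lp.coeFn_sum, Finset.sum_apply, lp.coeFn_smul,
    Pi.smul_apply, smul_eq_mul, matrixEntry]
  exact Finset.sum_congr rfl fun t _ => mul_comm _ _

theorem norm_sum_matrixEntry_le (A : lp (fun _ : T => ℂ) 2 →L[ℂ] lp (fun _ : S => ℂ) 2)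
    (F : Finset S) (G : Finset T) (η : S → ℂ) (ξ : T → ℂ) :
    ‖∑ s ∈ F, ∑ t ∈ G, η s * matrixEntry A s t * ξ t‖ ≤
      ‖A‖ * √(∑ s ∈ F, ‖η s‖ ^ 2) * √(∑ t ∈ G, ‖ξ t‖ ^ 2) := by
  have h1 : ∑ s ∈ F, ∑ t ∈ G, η s * matrixEntry A s t * ξ t =
      ∑ s ∈ F, η s * A (finsetVector G ξ) s := by
    refine Finset.sum_congr rfl fun s _ => ?_
    rw [apply_finsetVector, Finset.mul_sum]
    exact Finset.sum_congr rfl fun t _ => by ring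
  rw [h1]
  calc ‖∑ s ∈ F, η s * A (finsetVector G ξ) s‖
      ≤ ∑ s ∈ F, ‖η s‖ * ‖A (finsetVector G ξ) s‖ := by
        refine (norm_sum_le _ _).trans_eq ?_
        simp
    _ ≤ √(∑ s ∈ F, ‖η s‖ ^ 2) * √(∑ s ∈ F, ‖A (finsetVector G ξ) s‖ ^ 2) :=
        Real.sum_mul_le_sqrt_mul_sqrt _ _ _
    _ ≤ √(∑ s ∈ F, ‖η s‖ ^ 2) * (‖A‖ * √(∑ t ∈ G, ‖ξ t‖ ^ 2)) := by
        gcongr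
        rw [Real.sqrt_le_left (by positivity)]
        refine (lp_sum_norm_sq_le _ _).trans ?_
        gcongr
        exact (A.le_opNorm _).trans (by gcongr; exact norm_finsetVector_le _ _)
    _ = _ := by ring

/-- Finite bilinear bounds suffice: suitable phases make each row absolutely summable against `x`,
and testing the truncated image against its own conjugate bounds its norm uniformly. -/
theorem exists_operator_of_matrix {m : S → T → ℂ} {N : ℝ} (hN : 0 ≤ N)
    (h : ∀ (F : Finset S) (G : Finset T) (η : S → ℂ) (ξ : T → ℂ),
      ‖∑ s ∈ F, ∑ t ∈ G, η s * m s t * ξ t‖ ≤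
        N * √(∑ s ∈ F, ‖η s‖ ^ 2) * √(∑ t ∈ G, ‖ξ t‖ ^ 2)) :
    ∃ B : lp (fun _ : T => ℂ) 2 →L[ℂ] lp (fun _ : S => ℂ) 2,
      (∀ s t, matrixEntry B s t = m s t) ∧ ‖B‖ ≤ N := by
  have hsqrt : ∀ (x : lp (fun _ : T => ℂ) 2) (G : Finset T), √(∑ t ∈ G, ‖x t‖ ^ 2) ≤ ‖x‖ :=
    fun x G => (Real.sqrt_le_left (norm_nonneg _)).2 (lp_sum_norm_sq_le x G)
  have hsum : ∀ (x : lp (fun _ : T => ℂ) 2) s, Summable fun t => m s t * x t := by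
    intro x s
    refine Summable.of_norm (summable_of_sum_le (c := N * ‖x‖) (fun _ => norm_nonneg _) fun G => ?_)
    -- The phase turns each term into its absolute value; where the entry is zero the quotient is
    -- `0`, which is harmless.
    have h1 := h {s} G 1 fun t => conj (m s t) / ‖m s t‖ * ‖x t‖
    have h2 : ∀ t, m s t * (conj (m s t) / ‖m s t‖ * ‖x t‖) = (‖m s t * x t‖ : ℝ) := by
      intro t
      rw [← mul_assoc, ← mul_div_assoc, Complex.mul_conj']
      rcases eq_or_ne (m s t) 0 with h0 | h0
      · simp [h0]
      · have : (‖m s t‖ : ℂ) ≠ 0 := by simpa using h0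
        rw [norm_mul]
        push_cast
        field_simp
    simp only [Finset.sum_singleton, Pi.one_apply, one_mul, norm_one, one_pow, Real.sqrt_one,
      mul_one, h2] at h1
    rw [← Complex.ofReal_sum, Complex.norm_real, Real.norm_of_nonneg (by positivity)] at h1
    refine h1.trans ?_
    gcongr
    refine le_trans (Real.sqrt_le_sqrt (Finset.sum_le_sum fun t _ => ?_)) (hsqrt x G)
    gcongr
    rw [norm_mul, norm_div, RCLike.norm_conj, Complex.norm_real, Complex.norm_real, norm_norm,
      norm_norm]
    exact mul_le_of_le_one_left (norm_nonneg _) (div_self_le_one _)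
  have hfin : ∀ (x : lp (fun _ : T => ℂ) 2) (F : Finset S),
      ∑ s ∈ F, ‖∑' t, m s t * x t‖ ^ 2 ≤ (N * ‖x‖) ^ 2 := by
    intro x F
    have hlim : Filter.Tendsto (fun G : Finset T => ∑ s ∈ F, ‖∑ t ∈ G, m s t * x t‖ ^ 2)
        Filter.atTop (nhds (∑ s ∈ F, ‖∑' t, m s t * x t‖ ^ 2)) :=
      tendsto_finsetSum _ fun s _ => ((hsum x s).hasSum.norm).pow 2
    refine le_of_tendsto' hlim fun G => ?_
    set y : S → ℂ := fun s => ∑ t ∈ G, m s t * x t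
    have h1 := h F G (fun s => conj (y s)) x
    have h2 : ∑ s ∈ F, ∑ t ∈ G, conj (y s) * m s t * x t = ((∑ s ∈ F, ‖y s‖ ^ 2 : ℝ) : ℂ) := by
      push_cast
      refine Finset.sum_congr rfl fun s _ => ?_
      rw [← Complex.conj_mul', Finset.mul_sum]
      exact Finset.sum_congr rfl fun t _ => mul_assoc _ _ _
    simp only [RCLike.norm_conj] at h1
    rw [h2, Complex.norm_real, Real.norm_of_nonneg (by positivity)] at h1
    set Y := ∑ s ∈ F, ‖y s‖ ^ 2
    have hY : 0 ≤ Y := by positivity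
    have h3 : √Y * √Y ≤ (N * ‖x‖) * √Y := by
      rw [Real.mul_self_sqrt hY]
      refine h1.trans ?_
      rw [mul_right_comm]
      gcongr
      exact hsqrt x G
    have h4 : √Y ≤ N * ‖x‖ := by
      rcases (Real.sqrt_nonneg Y).eq_or_lt with h0 | h0
      · rw [← h0]; positivity
      · exact le_of_mul_le_mul_right h3 h0
    exact (Real.sqrt_le_left (by positivity)).1 h4
  let B₀ : lp (fun _ : T => ℂ) 2 →ₗ[ℂ] lp (fun _ : S => ℂ) 2 :=
    { toFun := fun x => ⟨fun s => ∑' t, m s t * x t, memlp_of_sum_norm_sq_le _ (hfin x)⟩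
      map_add' := by
        intro x y
        ext s
        simp only [lp.coeFn_add, Pi.add_apply, mul_add]
        exact (hsum x s).tsum_add (hsum y s)
      map_smul' := by
        intro a x
        ext s
        simp only [lp.coeFn_smul, Pi.smul_apply, smul_eq_mul, RingHom.id_apply]
        rw [← tsum_mul_left]
        exact tsum_congr fun t => by ring }
  have hB : ∀ x, ‖B₀ x‖ ≤ N * ‖x‖ := fun x =>
    lp_norm_le_of_sum_norm_sq_le (by positivity) _ (hfin x)
  refine ⟨B₀.mkContinuous N hB, fun s t => ?_, B₀.mkContinuous_norm_le hN hB⟩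
  classical
  change ∑' t', m s t' * (lp.single 2 t (1 : ℂ) : lp (fun _ : T => ℂ) 2) t' = m s t
  rw [tsum_eq_single t]
  · simp
  · intro t' h
    simp [h]

/-- The function `Ψ` multiplies matrices of bounded operators boundedly in the weak sense of
finite sections. -/
def FiniteSchurBound (Ψ : S × T → ℂ) (c : ℝ) : Prop :=
  ∀ (A : lp (fun _ : T => ℂ) 2 →L[ℂ] lp (fun _ : S => ℂ) 2) (F : Finset S) (G : Finset T)
    (η : S → ℂ) (ξ : T → ℂ),
    ‖∑ s ∈ F, ∑ t ∈ G, η s * (Ψ (s, t) * matrixEntry A s t) * ξ t‖ ≤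
      c * ‖A‖ * √(∑ s ∈ F, ‖η s‖ ^ 2) * √(∑ t ∈ G, ‖ξ t‖ ^ 2)

theorem FiniteSchurBound.exists_isSchurProduct {Ψ : S × T → ℂ} {c : ℝ} (hc : 0 ≤ c)
    (h : FiniteSchurBound Ψ c) (A : lp (fun _ : T => ℂ) 2 →L[ℂ] lp (fun _ : S => ℂ) 2) :
    ∃ B, IsSchurProduct Ψ A B ∧ ‖B‖ ≤ c * ‖A‖ :=
  exists_operator_of_matrix (by positivity) (h A)

theorem finiteSchurBound_of_exists_isSchurProduct {Ψ : S × T → ℂ} {c : ℝ}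
    (h : ∀ A : lp (fun _ : T => ℂ) 2 →L[ℂ] lp (fun _ : S => ℂ) 2,
      ∃ B, IsSchurProduct Ψ A B ∧ ‖B‖ ≤ c * ‖A‖) : FiniteSchurBound Ψ c := by
  intro A F G η ξ
  obtain ⟨B, hB, hn⟩ := h A
  simp only [← hB _ _]
  refine (norm_sum_matrixEntry_le B F G η ξ).trans ?_
  gcongr

/-- Each inequality involves finitely many values of the symbol, so pointwise limits along any
filter preserve it. -/
theorem FiniteSchurBound.of_tendsto {ι : Type*} {l : Filter ι} [l.NeBot] {Ψ : ι → S × T → ℂ}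
    {Ψ₀ : S × T → ℂ} {c : ℝ} (h : ∀ i, FiniteSchurBound (Ψ i) c)
    (hlim : ∀ z, Filter.Tendsto (fun i => Ψ i z) l (nhds (Ψ₀ z))) : FiniteSchurBound Ψ₀ c := by
  intro A F G η ξ
  have h1 : Filter.Tendsto (fun i => ‖∑ s ∈ F, ∑ t ∈ G,
      η s * (Ψ i (s, t) * matrixEntry A s t) * ξ t‖) l
      (nhds ‖∑ s ∈ F, ∑ t ∈ G, η s * (Ψ₀ (s, t) * matrixEntry A s t) * ξ t‖) :=
    (tendsto_finsetSum _ fun s _ => tendsto_finsetSum _ fun t _ =>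
      (((hlim (s, t)).mul_const _).const_mul _).mul_const _).norm
  exact le_of_tendsto' h1 fun i => h i A F G η ξ

open Classical in
theorem norm_ite_mem_le_sqrt_sum (F : Finset S) (s : S) (η : S → ℂ) :
    ‖(if s ∈ F then η s else 0)‖ ≤ √(∑ s ∈ F, ‖η s‖ ^ 2) := by
  refine Real.le_sqrt_of_sq_le ?_
  split_ifs with hs
  · exact Finset.single_le_sum (f := fun s => ‖η s‖ ^ 2) (fun _ _ => by positivity) hs
  · rw [norm_zero, zero_pow two_ne_zero]
    positivity

-- Tested on the matrix unit at `z`. The resulting uniform bound provides both the compactness for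
-- pointwise limits and the integrability of the symbol.
open Classical in
theorem FiniteSchurBound.norm_le {Ψ : S × T → ℂ} {c : ℝ} (hc : 0 ≤ c) (h : FiniteSchurBound Ψ c)
    (z : S × T) : ‖Ψ z‖ ≤ c := by
  obtain ⟨s₀, t₀⟩ := z
  obtain ⟨A, hA, hn⟩ := exists_operator_of_matrix (S := S) (T := T) (N := 1)
    (m := fun s t => if s = s₀ ∧ t = t₀ then 1 else 0) zero_le_one (by
      intro F G η ξ
      have : ∑ s ∈ F, ∑ t ∈ G, η s * (if s = s₀ ∧ t = t₀ then (1 : ℂ) else 0) * ξ t =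
          (if s₀ ∈ F then η s₀ else 0) * (if t₀ ∈ G then ξ t₀ else 0) := by
        rw [← Finset.sum_ite_eq' F s₀ η, ← Finset.sum_ite_eq' G t₀ ξ, Finset.sum_mul_sum]
        refine Finset.sum_congr rfl fun s _ => Finset.sum_congr rfl fun t _ => ?_
        by_cases h1 : s = s₀ <;> by_cases h2 : t = t₀ <;> simp [h1, h2]
      rw [this, norm_mul, one_mul]
      gcongr
      · exact norm_ite_mem_le_sqrt_sum F s₀ η
      · exact norm_ite_mem_le_sqrt_sum G t₀ ξ)
  have h1 := h A {s₀} {t₀} 1 1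
  simp only [Finset.sum_singleton, hA, and_self, if_true, Pi.one_apply, one_mul, mul_one, norm_one,
    one_pow, Real.sqrt_one] at h1
  exact h1.trans (mul_le_of_le_one_right hc hn)

end MatrixOperators

/-! ### Averages of a measure multiplier are discrete multipliers. -/

section Averages

set_option linter.unusedSectionVars false

open InnerProductSpace ComplexConjugate

variable {S T : Type*} [MeasurableSpace S] [MeasurableSpace T] {μ : Measure S} {ν : Measure T}

theorem L2_enorm_sq (f : Lp ℂ 2 μ) : ‖f‖ₑ ^ 2 = ∫⁻ x, ‖f x‖ₑ ^ 2 ∂μ := by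
  rw [Lp.enorm_def, eLpNorm_eq_lintegral_rpow_enorm_toReal (by norm_num) (by norm_num),
    ← ENNReal.rpow_two, ← ENNReal.rpow_mul]
  norm_num

theorem L2_norm_sq_le {f : Lp ℂ 2 μ} {C : ℝ} (hC : 0 ≤ C)
    (h : ∫⁻ x, ‖f x‖ₑ ^ 2 ∂μ ≤ ENNReal.ofReal C) : ‖f‖ ^ 2 ≤ C := by
  rw [← L2_enorm_sq, ← ofReal_norm, ← ENNReal.ofReal_pow (norm_nonneg _)] at h
  exact (ENNReal.ofReal_le_ofReal_iff hC).1 h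

theorem memLp_two_of_lintegral {f : S → ℂ} (hf : AEStronglyMeasurable f μ)
    (h : ∫⁻ x, ‖f x‖ₑ ^ 2 ∂μ < ∞) : MemLp f 2 μ := by
  refine ⟨hf, ?_⟩
  rw [eLpNorm_lt_top_iff_lintegral_rpow_enorm_lt_top (by norm_num) (by norm_num)]
  simpa using h

/-- Cauchy-Schwarz with `a` in one factor and `b * u` in the other. The weight `b` stays under the
integral so that a family of such bounds can be summed pointwise. -/
theorem enorm_inner_sq_le_of_enorm_eq_mul {w u : Lp ℂ 2 μ} {a b : S → ℝ≥0∞} (ha : Measurable a)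
    (hb : Measurable b) (hw : ∀ᵐ x ∂μ, ‖w x‖ₑ = a x * b x) (h1 : ∫⁻ x, a x ^ 2 ∂μ ≤ 1) :
    ‖(inner ℂ w u : ℂ)‖ₑ ^ 2 ≤ ∫⁻ x, b x ^ 2 * ‖u x‖ₑ ^ 2 ∂μ := by
  have hu : AEMeasurable (fun x => ‖u x‖ₑ) μ := (Lp.aestronglyMeasurable u).enorm
  have e1 : ‖(inner ℂ w u : ℂ)‖ₑ ≤ ∫⁻ x, a x * (b x * ‖u x‖ₑ) ∂μ := by
    rw [L2.inner_def]
    refine (enorm_integral_le_lintegral_enorm _).trans_eq (lintegral_congr_ae ?_)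
    filter_upwards [hw] with x hx
    rw [RCLike.inner_apply, enorm_mul, RCLike.enorm_conj, hx]
    ring
  have e2 := ENNReal.lintegral_mul_le_Lp_mul_Lq μ Real.HolderConjugate.two_two ha.aemeasurable
    (hb.aemeasurable.mul hu)
  simp only [Pi.mul_apply, ENNReal.rpow_two] at e2
  calc ‖(inner ℂ w u : ℂ)‖ₑ ^ 2 ≤ ((∫⁻ x, a x ^ 2 ∂μ) ^ (1 / 2 : ℝ) *
        (∫⁻ x, (b x * ‖u x‖ₑ) ^ 2 ∂μ) ^ (1 / 2 : ℝ)) ^ 2 := by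
        gcongr
        exact e1.trans e2
    _ = (∫⁻ x, a x ^ 2 ∂μ) * ∫⁻ x, (b x * ‖u x‖ₑ) ^ 2 ∂μ := by
        rw [mul_pow, ← ENNReal.rpow_two, ← ENNReal.rpow_two, ← ENNReal.rpow_mul, ← ENNReal.rpow_mul]
        norm_num
    _ ≤ 1 * ∫⁻ x, (b x * ‖u x‖ₑ) ^ 2 ∂μ := by gcongr
    _ = _ := by simp [mul_pow]

/-- Weighted densities `η i * p i` factor as `f * w i` with `‖f‖ ^ 2 ≤ ∑ ‖η i‖ ^ 2` and a Bessel
family `w`. -/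
theorem exists_bessel_factorization {ι : Type*} [Fintype ι] {p : ι → S → ℝ}
    (hm : ∀ i, Measurable (p i)) (h0 : ∀ i x, 0 ≤ p i x)
    (h1 : ∀ i, ∫⁻ x, ENNReal.ofReal (p i x) ∂μ ≤ 1) (η : ι → ℂ) :
    ∃ (f : Lp ℂ 2 μ) (w : ι → Lp ℂ 2 μ), ‖f‖ ≤ √(∑ i, ‖η i‖ ^ 2) ∧
      (∀ u : Lp ℂ 2 μ, ∑ i, ‖(inner ℂ (w i) u : ℂ)‖ ^ 2 ≤ ‖u‖ ^ 2) ∧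
      ∀ i, ∀ᵐ x ∂μ, f x * w i x = η i * p i x ∧ f x * conj (w i x) = conj (η i) * p i x := by
  -- The choice is `f = √ρ` and `w i = η i p i / √ρ`, so that the integral of `f ^ 2` is at most `∑
  -- ‖η i‖ ^ 2`.
  set ρ : S → ℝ := fun x => ∑ i, ‖η i‖ ^ 2 * p i x with hρ
  have hρm : Measurable ρ := Finset.measurable_fun_sum _ fun i _ => (hm i).const_mul _
  have hρ0 : ∀ x, 0 ≤ ρ x := fun x => Finset.sum_nonneg fun i _ => mul_nonneg (by positivity) (h0 i x)
  have hle : ∀ i x, ‖η i‖ ^ 2 * p i x ≤ ρ x := fun i x =>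
    Finset.single_le_sum (f := fun i => ‖η i‖ ^ 2 * p i x)
      (fun i _ => mul_nonneg (by positivity) (h0 i x)) (Finset.mem_univ i)
  set f₀ : S → ℂ := fun x => (√(ρ x) : ℝ) with hf₀
  set w₀ : ι → S → ℂ := fun i x => η i * (p i x / √(ρ x) : ℝ) with hw₀
  have hfm : Measurable f₀ := Complex.measurable_ofReal.comp hρm.sqrt
  have hwm : ∀ i, Measurable (w₀ i) := fun i =>
    (Complex.measurable_ofReal.comp ((hm i).div hρm.sqrt)).const_mul _
  have hfn : ∀ x, ‖f₀ x‖ₑ ^ 2 = ENNReal.ofReal (ρ x) := by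
    intro x
    rw [← ofReal_norm, ← ENNReal.ofReal_pow (norm_nonneg _), Complex.norm_real,
      Real.norm_of_nonneg (Real.sqrt_nonneg _), Real.sq_sqrt (hρ0 x)]
  have hfi : ∫⁻ x, ‖f₀ x‖ₑ ^ 2 ∂μ ≤ ENNReal.ofReal (∑ i, ‖η i‖ ^ 2) := by
    simp only [hfn, hρ]
    calc ∫⁻ x, ENNReal.ofReal (∑ i, ‖η i‖ ^ 2 * p i x) ∂μ
        = ∫⁻ x, ∑ i, ENNReal.ofReal (‖η i‖ ^ 2) * ENNReal.ofReal (p i x) ∂μ := by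
          refine lintegral_congr fun x => ?_
          rw [ENNReal.ofReal_sum_of_nonneg fun i _ => mul_nonneg (by positivity) (h0 i x)]
          exact Finset.sum_congr rfl fun i _ => ENNReal.ofReal_mul (by positivity)
      _ = ∑ i, ENNReal.ofReal (‖η i‖ ^ 2) * ∫⁻ x, ENNReal.ofReal (p i x) ∂μ := by
          rw [lintegral_finsetSum _ fun i _ => (hm i).ennreal_ofReal.const_mul _]
          exact Finset.sum_congr rfl fun i _ => lintegral_const_mul _ (hm i).ennreal_ofReal
      _ ≤ ∑ i, ENNReal.ofReal (‖η i‖ ^ 2) * 1 := by gcongr with i; exact h1 i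
      _ = _ := by
          simp only [mul_one]
          rw [ENNReal.ofReal_sum_of_nonneg fun i _ => by positivity]
  -- The modulus of `w i` splits as `a i * b i`, where `a i ^ 2 = p i` has integral at most one and
  -- `∑ b i ^ 2 ≤ 1` pointwise; this yields the Bessel inequality.
  set a : ι → S → ℝ≥0∞ := fun i x => ENNReal.ofReal √(p i x)
  set b : ι → S → ℝ≥0∞ := fun i x => ENNReal.ofReal (‖η i‖ * √(p i x) / √(ρ x))
  have hab : ∀ i x, ‖w₀ i x‖ₑ = a i x * b i x := by
    intro i x
    rw [← ofReal_norm, ← ENNReal.ofReal_mul (Real.sqrt_nonneg _), norm_mul, Complex.norm_real,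
      Real.norm_of_nonneg (div_nonneg (h0 i x) (Real.sqrt_nonneg _))]
    congr 1
    nth_rw 1 [← Real.mul_self_sqrt (h0 i x)]
    ring
  have ha2 : ∀ i x, a i x ^ 2 = ENNReal.ofReal (p i x) := fun i x => by
    rw [← ENNReal.ofReal_pow (Real.sqrt_nonneg _), Real.sq_sqrt (h0 i x)]
  have hb2 : ∀ i x, b i x ^ 2 = ENNReal.ofReal (‖η i‖ ^ 2 * p i x / ρ x) := fun i x => by
    rw [← ENNReal.ofReal_pow (by positivity), div_pow, mul_pow, Real.sq_sqrt (h0 i x),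
      Real.sq_sqrt (hρ0 x)]
  have hb1 : ∀ i x, b i x ^ 2 ≤ 1 := fun i x => by
    rw [hb2, ENNReal.ofReal_le_one]
    exact div_le_one_of_le₀ (hle i x) (hρ0 x)
  have hsum1 : ∀ x, ∑ i, b i x ^ 2 ≤ 1 := fun x => by
    simp only [hb2]
    rw [← ENNReal.ofReal_sum_of_nonneg fun i _ =>
      div_nonneg (mul_nonneg (by positivity) (h0 i x)) (hρ0 x), ENNReal.ofReal_le_one,
      ← Finset.sum_div]
    exact div_self_le_one _
  have hf : MemLp f₀ 2 μ :=
    memLp_two_of_lintegral hfm.aestronglyMeasurable (hfi.trans_lt ENNReal.ofReal_lt_top)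
  have hw : ∀ i, MemLp (w₀ i) 2 μ := fun i => by
    refine memLp_two_of_lintegral (hwm i).aestronglyMeasurable
      (lt_of_le_of_lt ?_ ((h1 i).trans_lt ENNReal.one_lt_top))
    refine lintegral_mono fun x => ?_
    rw [hab, mul_pow, ← ha2]
    exact mul_le_of_le_one_right' (hb1 i x)
  refine ⟨hf.toLp, fun i => (hw i).toLp, ?_, fun u => ?_, fun i => ?_⟩
  · refine Real.le_sqrt_of_sq_le (L2_norm_sq_le (by positivity) ?_)
    refine le_of_eq_of_le (lintegral_congr_ae ?_) hfi
    filter_upwards [hf.coeFn_toLp] with x hx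
    rw [hx]
  · have h2 : ∀ i, ‖(inner ℂ (hw i).toLp u : ℂ)‖ₑ ^ 2 ≤ ∫⁻ x, b i x ^ 2 * ‖u x‖ₑ ^ 2 ∂μ := by
      intro i
      refine enorm_inner_sq_le_of_enorm_eq_mul (a := a i) (hm i).sqrt.ennreal_ofReal
        (((hm i).sqrt.const_mul _).div hρm.sqrt).ennreal_ofReal ?_ ?_
      · filter_upwards [(hw i).coeFn_toLp] with x hx
        rw [hx, hab]
      · simpa only [ha2] using h1 i
    have h3 : ∑ i, ‖(inner ℂ (hw i).toLp u : ℂ)‖ₑ ^ 2 ≤ ‖u‖ₑ ^ 2 := by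
      refine (Finset.sum_le_sum fun i _ => h2 i).trans ?_
      have hbm : ∀ i, AEMeasurable (fun x => b i x ^ 2 * ‖u x‖ₑ ^ 2) μ := fun i =>
        ((((hm i).sqrt.const_mul _).div hρm.sqrt).ennreal_ofReal.pow_const 2).aemeasurable.mul
          ((Lp.aestronglyMeasurable u).enorm.pow_const 2)
      rw [← lintegral_finsetSum' _ fun i _ => hbm i, L2_enorm_sq]
      refine lintegral_mono fun x => ?_
      rw [← Finset.sum_mul]
      exact mul_le_of_le_one_left' (hsum1 x)
    simp only [← ofReal_norm, ← ENNReal.ofReal_pow (norm_nonneg _)] at h3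
    rw [← ENNReal.ofReal_sum_of_nonneg fun i _ => by positivity] at h3
    exact (ENNReal.ofReal_le_ofReal_iff (by positivity)).1 h3
  · filter_upwards [hf.coeFn_toLp, (hw i).coeFn_toLp] with x hx1 hx2
    rw [hx1, hx2]
    simp only [hf₀, hw₀, map_mul, Complex.conj_ofReal]
    -- Where `ρ` vanishes, either `η i` or `p i x` is zero, so division by zero does no harm.
    have key : (η i = 0) ∨ ((√(ρ x) : ℝ) : ℂ) * (p i x / √(ρ x) : ℝ) = p i x := by
      rcases eq_or_ne (ρ x) 0 with hz | hz
      · have h3 := hle i x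
        rw [hz] at h3
        have h4 : ‖η i‖ ^ 2 * p i x = 0 := le_antisymm h3 (mul_nonneg (by positivity) (h0 i x))
        rcases mul_eq_zero.1 h4 with h5 | h5
        · left; simpa using h5
        · right; simp [h5]
      · right
        have : √(ρ x) ≠ 0 := (Real.sqrt_ne_zero (hρ0 x)).2 hz
        rw [← Complex.ofReal_mul, mul_div_cancel₀ _ this]
    rcases key with hz | hz
    · simp [hz]
    · exact ⟨by rw [mul_left_comm, hz], by rw [mul_left_comm, hz]⟩

/-- This operator is the transpose of a finite section of `A` between the analysis map of `w` and
the synthesis map of `e`, both contractions by the Bessel inequalities. The estimate comes from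
pairing the image of `u` with itself. -/
theorem norm_sum_rankOne_matrixEntry_le {E H : Type*} [NormedAddCommGroup E]
    [InnerProductSpace ℂ E] [NormedAddCommGroup H] [InnerProductSpace ℂ H]
    (A : lp (fun _ : T => ℂ) 2 →L[ℂ] lp (fun _ : S => ℂ) 2) {F : Finset S} {G : Finset T}
    {w : F → H} {e : G → E} (hw : ∀ u, ∑ i, ‖(inner ℂ (w i) u : ℂ)‖ ^ 2 ≤ ‖u‖ ^ 2)
    (he : ∀ u, ∑ i, ‖(inner ℂ (e i) u : ℂ)‖ ^ 2 ≤ ‖u‖ ^ 2) :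
    ‖∑ k : F × G, rankOne ℂ (e k.2) (conj (matrixEntry A k.1 k.2) • w k.1)‖ ≤ ‖A‖ := by
  classical
  refine ContinuousLinearMap.opNorm_le_bound _ (norm_nonneg _) fun u => ?_
  set v := (∑ k : F × G, rankOne ℂ (e k.2) (conj (matrixEntry A k.1 k.2) • w k.1)) u with hv
  set α : S → ℂ := fun s => if h : s ∈ F then inner ℂ (w ⟨s, h⟩) u else 0
  set β : T → ℂ := fun t => if h : t ∈ G then inner ℂ v (e ⟨t, h⟩) else 0
  have hα : ∀ i : F, α i = inner ℂ (w i) u := fun i => by simp [α]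
  have hβ : ∀ i : G, β i = inner ℂ v (e i) := fun i => by simp [β]
  have h1 := norm_sum_matrixEntry_le A F G α β
  have h2 : ∑ s ∈ F, ∑ t ∈ G, α s * matrixEntry A s t * β t = inner ℂ v v := by
    nth_rw 2 [hv]
    rw [_root_.sum_apply, inner_sum, Fintype.sum_prod_type, ← Finset.sum_coe_sort F]
    refine Finset.sum_congr rfl fun i _ => ?_
    rw [← Finset.sum_coe_sort G]
    refine Finset.sum_congr rfl fun j _ => ?_
    rw [hα, hβ, rankOne_apply, inner_smul_left, inner_smul_right, Complex.conj_conj]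
    ring
  have h3 : √(∑ s ∈ F, ‖α s‖ ^ 2) ≤ ‖u‖ := by
    rw [Real.sqrt_le_left (norm_nonneg _), ← Finset.sum_coe_sort F]
    simp only [hα]
    exact hw u
  have h4 : √(∑ t ∈ G, ‖β t‖ ^ 2) ≤ ‖v‖ := by
    rw [Real.sqrt_le_left (norm_nonneg _), ← Finset.sum_coe_sort G]
    simp only [hβ, norm_inner_symm v]
    exact he v
  rw [h2, inner_self_eq_norm_sq_to_K] at h1
  have h5 : ‖v‖ * ‖v‖ ≤ ‖A‖ * ‖u‖ * ‖v‖ := by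
    have : ‖((‖v‖ : ℂ)) ^ 2‖ = ‖v‖ * ‖v‖ := by simp [sq]
    rw [← this]
    refine h1.trans ?_
    gcongr
  rcases (norm_nonneg v).eq_or_lt with h0 | h0
  · rw [← h0]; positivity
  · exact le_of_mul_le_mul_right h5 h0

/-- Factoring `η s p s = f * conj (w s)` and `ξ t q t = g * e t` moves the vectors `η`, `ξ` into the
kernel `Φ (f ⊗ g)`. The matrix of `A` becomes the coefficients of a finite rank operator of norm at
most `‖A‖`, so the Schur form is a trace pairing. -/
theorem TensorFormBound.finiteSchurBound_average [SigmaFinite μ] [SigmaFinite ν] {Φ : S × T → ℂ}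
    {c : ℝ} (hc : 0 ≤ c) (h : TensorFormBound μ ν Φ c) {p : S → S → ℝ} {q : T → T → ℝ}
    (hpm : ∀ s, Measurable (p s)) (hp0 : ∀ s x, 0 ≤ p s x)
    (hp1 : ∀ s, ∫⁻ x, ENNReal.ofReal (p s x) ∂μ ≤ 1)
    (hqm : ∀ t, Measurable (q t)) (hq0 : ∀ t y, 0 ≤ q t y)
    (hq1 : ∀ t, ∫⁻ y, ENNReal.ofReal (q t y) ∂ν ≤ 1) :
    FiniteSchurBound (fun a => ∫ z, Φ z * (p a.1 z.1 * q a.2 z.2 : ℝ) ∂(μ.prod ν)) c := by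
  intro A F G η ξ
  -- The weights are conjugated because `w` enters the pairing conjugated.
  obtain ⟨f, w, hf, hw, hfw⟩ := exists_bessel_factorization (ι := F) (fun i => hpm i)
    (fun i => hp0 i) (fun i => hp1 i) fun i => conj (η i)
  obtain ⟨g, e, hg, he, hge⟩ := exists_bessel_factorization (ι := G) (fun i => hqm i)
    (fun i => hq0 i) (fun i => hq1 i) fun i => ξ i
  have h1 : ‖∑ k : F × G, ∫ z, Φ z * (f z.1 * g z.2) *
      (conj ((conj (matrixEntry A k.1 k.2) • w k.1 : Lp ℂ 2 μ) z.1) * e k.2 z.2) ∂(μ.prod ν)‖ ≤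
      c * ‖f‖ * ‖g‖ * ‖∑ k : F × G, rankOne ℂ (e k.2) (conj (matrixEntry A k.1 k.2) • w k.1)‖ := by
    have := h f g _ ((fun k : F × G => conj (matrixEntry A k.1 k.2) • w k.1) ∘
      (Fintype.equivFin (F × G)).symm) ((fun k => e k.2) ∘ (Fintype.equivFin (F × G)).symm)
    simp only [Function.comp_apply] at this
    rwa [(Fintype.equivFin (F × G)).symm.sum_comp fun k => ∫ z, Φ z * (f z.1 * g z.2) *
      (conj ((conj (matrixEntry A k.1 k.2) • w k.1 : Lp ℂ 2 μ) z.1) * e k.2 z.2) ∂(μ.prod ν),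
      (Fintype.equivFin (F × G)).symm.sum_comp fun k =>
        rankOne ℂ (e k.2) (conj (matrixEntry A k.1 k.2) • w k.1)] at this
  have h2 : ∑ s ∈ F, ∑ t ∈ G, η s * ((∫ z, Φ z * (p s z.1 * q t z.2 : ℝ) ∂(μ.prod ν)) *
      matrixEntry A s t) * ξ t = ∑ k : F × G, ∫ z, Φ z * (f z.1 * g z.2) *
      (conj ((conj (matrixEntry A k.1 k.2) • w k.1 : Lp ℂ 2 μ) z.1) * e k.2 z.2) ∂(μ.prod ν) := by
    rw [Fintype.sum_prod_type, ← Finset.sum_coe_sort F]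
    refine Finset.sum_congr rfl fun i _ => ?_
    rw [← Finset.sum_coe_sort G]
    refine Finset.sum_congr rfl fun j _ => ?_
    have : ∀ I : ℂ, η i * (I * matrixEntry A i j) * ξ j = η i * matrixEntry A i j * ξ j * I :=
      fun I => by ring
    rw [this, ← integral_const_mul]
    refine integral_congr_ae ?_
    filter_upwards [ae_fst (ν := ν) (hfw i), ae_snd (μ := μ) (hge j),
      ae_fst (ν := ν) (Lp.coeFn_smul (conj (matrixEntry A i j)) (w i))] with z hz1 hz2 hz3
    rw [hz3, Pi.smul_apply, smul_eq_mul, map_mul, Complex.conj_conj]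
    have e1 := hz1.2
    have e2 := hz2.1
    rw [Complex.conj_conj] at e1
    calc _ = Φ z * (matrixEntry A i j) * (η i * p i z.1) * (ξ j * q j z.2) := by
          push_cast; ring
      _ = _ := by rw [← e1, ← e2]; ring
  rw [h2]
  refine h1.trans ?_
  have h3 : ∑ i : F, ‖conj (η i)‖ ^ 2 = ∑ s ∈ F, ‖η s‖ ^ 2 := by
    simp only [RCLike.norm_conj]
    exact Finset.sum_coe_sort F fun s => ‖η s‖ ^ 2
  have h4 : ∑ i : G, ‖ξ i‖ ^ 2 = ∑ t ∈ G, ‖ξ t‖ ^ 2 := Finset.sum_coe_sort G fun t => ‖ξ t‖ ^ 2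
  rw [h3] at hf
  rw [h4] at hg
  calc _ ≤ c * √(∑ s ∈ F, ‖η s‖ ^ 2) * √(∑ t ∈ G, ‖ξ t‖ ^ 2) * ‖A‖ := by
        gcongr
        exact norm_sum_rankOne_matrixEntry_le A hw he
    _ = _ := by ring

end Averages

/-! ### An everywhere defined representative. -/

section EverywhereDefined

set_option linter.unusedSectionVars false

open ComplexConjugate Filter Topology

variable {S T : Type*} [MeasurableSpace S] [MeasurableSpace T] {μ : Measure S} {ν : Measure T}
  [SigmaFinite μ] [SigmaFinite ν]

/-- Apply the multiplier to the product of the indicators of `X` and `Y`: `Φ` is square integrable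
on the rectangle, whose measure is finite. -/
theorem IsMeasureSchurMultiplier.integrableOn {Φ : S × T → ℂ}
    (hΦ : IsMeasureSchurMultiplier μ ν Φ) {X : Set S} {Y : Set T} (hX : MeasurableSet X)
    (hY : MeasurableSet Y) (hμX : μ X ≠ ∞) (hνY : ν Y ≠ ∞) :
    Integrable Φ ((μ.restrict X).prod (ν.restrict Y)) := by
  have : Fact (μ X < ∞) := ⟨hμX.lt_top⟩
  have : Fact (ν Y < ∞) := ⟨hνY.lt_top⟩
  have h1 := hΦ.memLp (indicatorConstLp 2 hX hμX 1) (indicatorConstLp 2 hY hνY 1)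
  have h2 := h1.restrict (X ×ˢ Y)
  rw [← Measure.prod_restrict] at h2
  refine (MemLp.integrable one_le_two h2).congr ?_
  have e1 : ∀ᵐ s ∂(μ.restrict X), indicatorConstLp 2 hX hμX (1 : ℂ) s = 1 := by
    filter_upwards [ae_restrict_of_ae (indicatorConstLp_coeFn (p := 2) (hs := hX) (hμs := hμX)
      (c := (1 : ℂ))), ae_restrict_mem hX] with s hs hs'
    rw [hs, Set.indicator_of_mem hs']
  have e2 : ∀ᵐ t ∂(ν.restrict Y), indicatorConstLp 2 hY hνY (1 : ℂ) t = 1 := by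
    filter_upwards [ae_restrict_of_ae (indicatorConstLp_coeFn (p := 2) (hs := hY) (hμs := hνY)
      (c := (1 : ℂ))), ae_restrict_mem hY] with s hs hs'
    rw [hs, Set.indicator_of_mem hs']
  filter_upwards [ae_fst e1, ae_snd e2] with z hz1 hz2
  rw [hz1, hz2, mul_one, mul_one]

theorem lintegral_ofReal_indicator_inv_le_one (μ : Measure S) {C : Set S} (hC : MeasurableSet C) :
    ∫⁻ x, ENNReal.ofReal (C.indicator (fun _ => (μ.real C)⁻¹) x) ∂μ ≤ 1 := by
  have : ∀ x, ENNReal.ofReal (C.indicator (fun _ => (μ.real C)⁻¹) x) =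
      C.indicator (fun _ => ENNReal.ofReal (μ.real C)⁻¹) x := by
    intro x
    by_cases hx : x ∈ C <;> simp [hx]
  simp_rw [this]
  rw [lintegral_indicator_const hC]
  rcases eq_or_ne (μ.real C) 0 with h0 | h0
  · simp [h0]
  · have hpos : 0 < μ.real C := lt_of_le_of_ne measureReal_nonneg h0.symm
    have htop : μ C ≠ ∞ := fun h => h0 (by simp [Measure.real, h])
    rw [← ENNReal.ofReal_toReal htop, ← ENNReal.ofReal_mul (by positivity)]
    rw [show (μ C).toReal = μ.real C from rfl, inv_mul_cancel₀ h0, ENNReal.ofReal_one]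

theorem setAverage_prod_eq_integral_indicator {Φ : S × T → ℂ} {P X : Set S} {Q Y : Set T}
    (hP : MeasurableSet P) (hX : MeasurableSet X) (hQ : MeasurableSet Q) (hY : MeasurableSet Y) :
    (⨍ z in P ×ˢ Q, Φ z ∂((μ.restrict X).prod (ν.restrict Y))) =
      ∫ z, Φ z * (((P ∩ X).indicator (fun _ => (μ.real (P ∩ X))⁻¹) z.1 *
        (Q ∩ Y).indicator (fun _ => (ν.real (Q ∩ Y))⁻¹) z.2 : ℝ) : ℂ) ∂(μ.prod ν) := by
  rw [setAverage_eq, Measure.prod_restrict, Measure.restrict_restrict (hP.prod hQ),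
    Measure.real, Measure.restrict_apply (hP.prod hQ), Set.prod_inter_prod, Measure.prod_prod,
    ENNReal.toReal_mul, ← integral_indicator ((hP.inter hX).prod (hQ.inter hY)), ← integral_smul]
  refine integral_congr_ae (.of_forall fun z => ?_)
  obtain ⟨s, t⟩ := z
  by_cases h1 : s ∈ P ∩ X
  · by_cases h2 : t ∈ Q ∩ Y
    · simp only [Set.indicator_of_mem (show (s, t) ∈ (P ∩ X) ×ˢ (Q ∩ Y) from ⟨h1, h2⟩),
        Set.indicator_of_mem h1, Set.indicator_of_mem h2, Measure.real, Complex.real_smul]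
      push_cast
      ring
    · have : (s, t) ∉ (P ∩ X) ×ˢ (Q ∩ Y) := fun h => h2 h.2
      simp [Set.indicator_of_notMem h2, Set.indicator_of_notMem this]
  · have : (s, t) ∉ (P ∩ X) ×ˢ (Q ∩ Y) := fun h => h1 h.1
    simp [Set.indicator_of_notMem h1, Set.indicator_of_notMem this]

/-- Take `Ψ (s, t)` to be the average of `Φ` over the part in `X ×ˢ Y` of the grid cell containing
`(s, t)`. The densities are normalized indicators depending on `s` and `t` separately; on null cells
they are zero, still of integral at most one. -/
theorem exists_finiteSchurBound_close {Φ : S × T → ℂ} (hΦ : IsMeasureSchurMultiplier μ ν Φ) {c : ℝ}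
    (hc : 0 ≤ c) (h : TensorFormBound μ ν Φ c) {X : Set S} {Y : Set T} (hX : MeasurableSet X)
    (hY : MeasurableSet Y) (hμX : μ X ≠ ∞) (hνY : ν Y ≠ ∞) {ε : ℝ} (hε : 0 < ε) :
    ∃ Ψ : S × T → ℂ, Measurable Ψ ∧ FiniteSchurBound Ψ c ∧
      ∫⁻ z in X ×ˢ Y, ‖Ψ z - Φ z‖ₑ ∂(μ.prod ν) ≤ ENNReal.ofReal ε := by
  have : Fact (μ X < ∞) := ⟨hμX.lt_top⟩
  have : Fact (ν Y < ∞) := ⟨hνY.lt_top⟩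
  have hint := hΦ.integrableOn hX hY hμX hνY
  obtain ⟨ι, κ, _, _, τ, σ, hτ, hσ, hlt⟩ := exists_cellAverage_integral_norm_sub_lt hint hε
  set Ψ : S × T → ℂ := fun a => ⨍ z in (τ ⁻¹' {τ a.1}) ×ˢ (σ ⁻¹' {σ a.2}), Φ z
    ∂((μ.restrict X).prod (ν.restrict Y)) with hΨ
  have hgrid := measurableSet_preimage_prodMap hτ hσ
  set av : ι × κ → ℂ := fun p => ⨍ z in (τ ⁻¹' {p.1}) ×ˢ (σ ⁻¹' {p.2}), Φ z
    ∂((μ.restrict X).prod (ν.restrict Y))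
  have hm : Measurable Ψ := measurable_comp_of_preimage_singleton hgrid av
  refine ⟨Ψ, hm, ?_, ?_⟩
  · have := h.finiteSchurBound_average hc
      (p := fun s => (τ ⁻¹' {τ s} ∩ X).indicator fun _ => (μ.real (τ ⁻¹' {τ s} ∩ X))⁻¹)
      (q := fun t => (σ ⁻¹' {σ t} ∩ Y).indicator fun _ => (ν.real (σ ⁻¹' {σ t} ∩ Y))⁻¹)
      (fun s => measurable_const.indicator ((hτ _).inter hX))
      (fun s x => Set.indicator_nonneg (fun _ _ => by positivity) x)
      (fun s => lintegral_ofReal_indicator_inv_le_one μ ((hτ _).inter hX))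
      (fun t => measurable_const.indicator ((hσ _).inter hY))
      (fun t y => Set.indicator_nonneg (fun _ _ => by positivity) y)
      (fun t => lintegral_ofReal_indicator_inv_le_one ν ((hσ _).inter hY))
    convert this using 1
    ext a
    exact setAverage_prod_eq_integral_indicator (hτ _) hX (hσ _) hY
  · have hi : Integrable (fun z => Ψ z - Φ z) ((μ.restrict X).prod (ν.restrict Y)) :=
      (integrable_comp_of_preimage_singleton hgrid av).sub hint
    rw [← Measure.prod_restrict, ← ofReal_integral_norm_eq_lintegral_enorm hi]
    exact ENNReal.ofReal_le_ofReal hlt.le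

/-- Errors `2⁻ⁿ` on an exhaustion force convergence to `Φ` almost everywhere, since a summable
series of integrals is finite pointwise a.e. -/
theorem exists_ae_eq_finiteSchurBound {Φ : S × T → ℂ} (hΦ : IsMeasureSchurMultiplier μ ν Φ) {c : ℝ}
    (hc : 0 ≤ c) (h : TensorFormBound μ ν Φ c) :
    ∃ Φ₀ : S × T → ℂ, FiniteSchurBound Φ₀ c ∧ Φ₀ =ᵐ[μ.prod ν] Φ := by
  choose Ψ hΨm hΨ hΨi using fun n : ℕ => exists_finiteSchurBound_close hΦ hc h
    (measurableSet_spanningSets μ n) (measurableSet_spanningSets ν n)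
    (measure_spanningSets_lt_top μ n).ne (measure_spanningSets_lt_top ν n).ne
    (ε := (1 / 2 : ℝ) ^ n) (by positivity)
  -- Values lie in a compact disc, so an ultrafilter limit exists at every point, including those
  -- where the sequence diverges; it refines `atTop` and so keeps ordinary limits.
  set U : Ultrafilter ℕ := hyperfilter ℕ
  have hU : (U : Filter ℕ) ≤ atTop := Nat.hyperfilter_le_atTop
  have hlim : ∀ z, ∃ a, Tendsto (fun n => Ψ n z) U (𝓝 a) := by
    intro z
    obtain ⟨a, -, ha⟩ := (isCompact_closedBall (0 : ℂ) c).ultrafilter_le_nhds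
      (U.map fun n => Ψ n z) (by
        rw [Ultrafilter.coe_map, le_principal_iff, mem_map]
        exact Filter.univ_mem' fun n => mem_closedBall_zero_iff.2 ((hΨ n).norm_le hc z))
    exact ⟨a, ha⟩
  choose Φ₀ hΦ₀ using hlim
  refine ⟨Φ₀, FiniteSchurBound.of_tendsto hΨ hΦ₀, ?_⟩
  set G : ℕ → S × T → ℝ≥0∞ := fun n => (spanningSets μ n ×ˢ spanningSets ν n).indicator
    fun z => ‖Ψ n z - Φ z‖ₑ with hG
  have hmeas : ∀ n, MeasurableSet (spanningSets μ n ×ˢ spanningSets ν n) := fun n =>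
    (measurableSet_spanningSets μ n).prod (measurableSet_spanningSets ν n)
  have hGm : ∀ n, AEMeasurable (G n) (μ.prod ν) := fun n =>
    (((hΨm n).aestronglyMeasurable.sub hΦ.1).enorm).indicator (hmeas n)
  have hsum : ∫⁻ z, ∑' n, G n z ∂(μ.prod ν) ≠ ∞ := by
    rw [lintegral_tsum hGm]
    refine ne_top_of_le_ne_top (b := ∑' n : ℕ, ENNReal.ofReal ((1 / 2 : ℝ) ^ n)) ?_ ?_
    · rw [← ENNReal.ofReal_tsum_of_nonneg (fun n => by positivity) summable_geometric_two]
      exact ENNReal.ofReal_ne_top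
    · refine ENNReal.tsum_le_tsum fun n => ?_
      rw [hG, lintegral_indicator (hmeas n)]
      exact hΨi n
  filter_upwards [ae_lt_top' (AEMeasurable.tsum hGm) hsum] with z hz
  have h1 : Tendsto (fun n => G n z) atTop (𝓝 0) :=
    ENNReal.tendsto_atTop_zero_of_tsum_ne_top hz.ne
  have h2 : Tendsto (fun n => ‖Ψ n z - Φ z‖ₑ) atTop (𝓝 0) := by
    refine h1.congr' ?_
    filter_upwards [eventually_mem_spanningSets μ z.1, eventually_mem_spanningSets ν z.2]
      with n hn1 hn2
    exact Set.indicator_of_mem (show z ∈ spanningSets μ n ×ˢ spanningSets ν n from ⟨hn1, hn2⟩) _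
  have h3 : Tendsto (fun n => Ψ n z) atTop (𝓝 (Φ z)) := by
    rw [tendsto_iff_edist_tendsto_0]
    simpa only [edist_eq_enorm_sub] using h2
  exact tendsto_nhds_unique (hΦ₀ z) (h3.mono_left hU)

end EverywhereDefined

/-! ### Cell averages by random sampling of points. -/

section Sampling

set_option linter.unusedSectionVars false

open ComplexConjugate ProbabilityTheory

variable {S T : Type*}

open Classical in
theorem sum_norm_sq_ite_mem_le {X K : Type*} [Fintype K] {ρ : K → X} (hρ : Function.Injective ρ)
    (F : Finset X) (η : X → ℂ) :
    ∑ i, ‖(if ρ i ∈ F then η (ρ i) else 0)‖ ^ 2 ≤ ∑ s ∈ F, ‖η s‖ ^ 2 := by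
  have h1 : ∀ i, ‖(if ρ i ∈ F then η (ρ i) else 0)‖ ^ 2 =
      (fun s => if s ∈ F then ‖η s‖ ^ 2 else 0) (ρ i) := fun i => by
    by_cases hi : ρ i ∈ F <;> simp [hi]
  simp only [h1]
  rw [← Finset.sum_image (f := fun s => if s ∈ F then ‖η s‖ ^ 2 else 0) (g := ρ)
    (fun _ _ _ _ h => hρ h), ← Finset.sum_filter]
  refine Finset.sum_le_sum_of_subset_of_nonneg ?_ fun _ _ _ => by positivity
  intro s hs
  exact (Finset.mem_filter.1 hs).2

open Classical in
/-- A bound for `Ψ` on matrices indexed by `S × T` passes to submatrices of `Ψ` whose rows and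
columns are distinct. -/
theorem FiniteSchurBound.norm_sum_sample_le {Ψ : S × T → ℂ} {c : ℝ} (hc : 0 ≤ c)
    (h : FiniteSchurBound Ψ c) {I J : Type*} [Fintype I] [Fintype J] {σ : I → S} {τ : J → T}
    (hσ : Function.Injective σ) (hτ : Function.Injective τ) {α : I → J → ℂ} {N : ℝ} (hN : 0 ≤ N)
    (hα : ∀ (y : I → ℂ) (x : J → ℂ), ‖∑ i, ∑ j, y i * α i j * x j‖ ≤
      N * √(∑ i, ‖y i‖ ^ 2) * √(∑ j, ‖x j‖ ^ 2)) (y : I → ℂ) (x : J → ℂ) :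
    ‖∑ i, ∑ j, y i * (Ψ (σ i, τ j) * α i j) * x j‖ ≤
      c * N * √(∑ i, ‖y i‖ ^ 2) * √(∑ j, ‖x j‖ ^ 2) := by
  -- The matrix `α` is placed in the rows `σ i` and columns `τ j`, with zeros elsewhere; injectivity
  -- keeps its entries and norm bound.
  obtain ⟨A, hA, hn⟩ := exists_operator_of_matrix (S := S) (T := T) (N := N)
    (m := fun s t => ∑ i, ∑ j, if s = σ i ∧ t = τ j then α i j else 0) hN (by
      intro F G η ξ
      have : ∑ s ∈ F, ∑ t ∈ G, η s * (∑ i, ∑ j, if s = σ i ∧ t = τ j then α i j else 0) * ξ t =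
          ∑ i, ∑ j, (if σ i ∈ F then η (σ i) else 0) * α i j * (if τ j ∈ G then ξ (τ j) else 0) := by
        simp only [Finset.mul_sum, Finset.sum_mul]
        have e1 : ∀ s ∈ F, ∑ t ∈ G, ∑ i, ∑ j, η s * (if s = σ i ∧ t = τ j then α i j else 0) * ξ t =
            ∑ i, ∑ j, (if s = σ i then η s else 0) * α i j *
              (if τ j ∈ G then ξ (τ j) else 0) := by
          intro s _
          rw [Finset.sum_comm]
          refine Finset.sum_congr rfl fun i _ => ?_
          rw [Finset.sum_comm]
          refine Finset.sum_congr rfl fun j _ => ?_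
          rw [← Finset.sum_ite_eq' G (τ j) ξ, Finset.mul_sum]
          refine Finset.sum_congr rfl fun t _ => ?_
          by_cases h1 : s = σ i <;> by_cases h2 : t = τ j <;> simp [h1, h2]
        rw [Finset.sum_congr rfl e1, Finset.sum_comm]
        refine Finset.sum_congr rfl fun i _ => ?_
        rw [Finset.sum_comm]
        refine Finset.sum_congr rfl fun j _ => ?_
        rw [← Finset.sum_mul, ← Finset.sum_mul, Finset.sum_ite_eq']
      rw [this]
      refine (hα _ _).trans ?_
      gcongr N * √?_ * √?_
      · exact sum_norm_sq_ite_mem_le hσ F η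
      · exact sum_norm_sq_ite_mem_le hτ G ξ)
  have hAe : ∀ i j, matrixEntry A (σ i) (τ j) = α i j := by
    intro i j
    rw [hA, Finset.sum_eq_single i, Finset.sum_eq_single j]
    · simp
    · intro j' _ hj
      simp [hτ.eq_iff, hj.symm]
    · simp
    · intro i' _ hi
      simp [hσ.eq_iff, hi.symm]
    · simp
  have h1 := h A (Finset.univ.map ⟨σ, hσ⟩) (Finset.univ.map ⟨τ, hτ⟩) (Function.extend σ y 0)
    (Function.extend τ x 0)
  simp only [Finset.sum_map, Function.Embedding.coeFn_mk, hσ.extend_apply, hτ.extend_apply,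
    hAe] at h1
  refine h1.trans ?_
  gcongr

variable [MeasurableSpace S] [MeasurableSpace T] {μ : Measure S} {ν : Measure T}
  [SigmaFinite μ] [SigmaFinite ν]

theorem integral_cond_prod_cond {Φ : S × T → ℂ} {P : Set S} {Q : Set T}
    (hP : MeasurableSet P) (hQ : MeasurableSet Q) :
    ∫ z, Φ z ∂((μ[|P]).prod (ν[|Q])) =
      ∫ z, Φ z * ((P.indicator (fun _ => (μ.real P)⁻¹) z.1 *
        Q.indicator (fun _ => (ν.real Q)⁻¹) z.2 : ℝ) : ℂ) ∂(μ.prod ν) := by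
  have := setAverage_prod_eq_integral_indicator (Φ := Φ) (μ := μ) (ν := ν) hP hP hQ hQ
  simp only [Set.inter_self] at this
  rw [← this, setAverage_eq, Measure.prod_restrict, Measure.restrict_restrict (hP.prod hQ),
    Set.inter_self, Measure.real, Measure.restrict_apply (hP.prod hQ), Set.inter_self,
    Measure.prod_prod, ProbabilityTheory.cond, ProbabilityTheory.cond, Measure.prod_smul_left, Measure.prod_smul_right,
    Measure.prod_restrict, integral_smul_measure, integral_smul_measure, smul_smul]
  simp [ENNReal.toReal_inv, ENNReal.toReal_mul, mul_comm]

/-- Choose independent points, one in each `P i` and each `Q j`, with the normalized restricted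
measures. Each cell average is the expectation of `Ψ` at a pair of these points. Disjointness makes
the points distinct almost surely, so every sample satisfies the discrete bound, and so does the
expectation. -/
theorem FiniteSchurBound.norm_sum_average_le {Ψ : S × T → ℂ} {c : ℝ} (hc : 0 ≤ c)
    (h : FiniteSchurBound Ψ c) (hm : AEStronglyMeasurable Ψ (μ.prod ν)) {I J : Type*} [Fintype I]
    [Fintype J] {P : I → Set S} {Q : J → Set T} (hPm : ∀ i, MeasurableSet (P i))
    (hQm : ∀ j, MeasurableSet (Q j)) (hPd : Pairwise (Function.onFun Disjoint P))
    (hQd : Pairwise (Function.onFun Disjoint Q)) (hP0 : ∀ i, μ (P i) ≠ 0) (hQ0 : ∀ j, ν (Q j) ≠ 0)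
    (hPt : ∀ i, μ (P i) ≠ ∞) (hQt : ∀ j, ν (Q j) ≠ ∞) {α : I → J → ℂ} {N : ℝ} (hN : 0 ≤ N)
    (hα : ∀ (y : I → ℂ) (x : J → ℂ), ‖∑ i, ∑ j, y i * α i j * x j‖ ≤
      N * √(∑ i, ‖y i‖ ^ 2) * √(∑ j, ‖x j‖ ^ 2)) (y : I → ℂ) (x : J → ℂ) :
    ‖∑ i, ∑ j, y i * ((∫ z, Ψ z * (((P i).indicator (fun _ => (μ.real (P i))⁻¹) z.1 *
        (Q j).indicator (fun _ => (ν.real (Q j))⁻¹) z.2 : ℝ) : ℂ) ∂(μ.prod ν)) * α i j) * x j‖ ≤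
      c * N * √(∑ i, ‖y i‖ ^ 2) * √(∑ j, ‖x j‖ ^ 2) := by
  have hp1 : ∀ i, IsProbabilityMeasure (μ[|P i]) := fun i => cond_isProbabilityMeasure_of_finite
    (hP0 i) (hPt i)
  have hq1 : ∀ j, IsProbabilityMeasure (ν[|Q j]) := fun j => cond_isProbabilityMeasure_of_finite
    (hQ0 j) (hQt j)
  set Ps := Measure.pi fun i => μ[|P i]
  set Qs := Measure.pi fun j => ν[|Q j]
  have hpres : ∀ i j, MeasurePreserving (fun ω : (I → S) × (J → T) => (ω.1 i, ω.2 j)) (Ps.prod Qs)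
      ((μ[|P i]).prod (ν[|Q j])) := fun i j =>
    (measurePreserving_eval (fun i => μ[|P i]) i).prod (measurePreserving_eval (fun j => ν[|Q j]) j)
  have hac : ∀ i j, ((μ[|P i]).prod (ν[|Q j])).AbsolutelyContinuous (μ.prod ν) := fun i j =>
    (cond_absolutelyContinuous).prod cond_absolutelyContinuous
  have hmeas : ∀ i j, AEStronglyMeasurable Ψ ((μ[|P i]).prod (ν[|Q j])) := fun i j =>
    hm.mono_ac (hac i j)
  have hint : ∀ i j, Integrable (fun ω : (I → S) × (J → T) => Ψ (ω.1 i, ω.2 j)) (Ps.prod Qs) :=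
    fun i j => Integrable.of_bound ((hmeas i j).comp_measurePreserving (hpres i j)) c
      (.of_forall fun ω => h.norm_le hc _)
  have hval : ∀ i j, ∫ z, Ψ z * (((P i).indicator (fun _ => (μ.real (P i))⁻¹) z.1 *
        (Q j).indicator (fun _ => (ν.real (Q j))⁻¹) z.2 : ℝ) : ℂ) ∂(μ.prod ν) =
      ∫ ω, Ψ (ω.1 i, ω.2 j) ∂(Ps.prod Qs) := by
    intro i j
    rw [← integral_cond_prod_cond (hPm i) (hQm j), ← (hpres i j).map_eq,
      integral_map (hpres i j).aemeasurable]
    rw [(hpres i j).map_eq]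
    exact hmeas i j
  have hsum : ∑ i, ∑ j, y i * ((∫ ω, Ψ (ω.1 i, ω.2 j) ∂(Ps.prod Qs)) * α i j) * x j =
      ∫ ω, ∑ i, ∑ j, y i * (Ψ (ω.1 i, ω.2 j) * α i j) * x j ∂(Ps.prod Qs) := by
    rw [integral_finsetSum _ fun i _ => integrable_finsetSum _ fun j _ =>
      (((hint i j).mul_const _).const_mul _).mul_const _]
    refine Finset.sum_congr rfl fun i _ => ?_
    rw [integral_finsetSum _ fun j _ => (((hint i j).mul_const _).const_mul _).mul_const _]
    refine Finset.sum_congr rfl fun j _ => ?_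
    rw [integral_mul_const, integral_const_mul, integral_mul_const]
  simp only [hval]
  rw [hsum]
  have hmem1 : ∀ᵐ ω ∂Ps, ∀ i, ω i ∈ P i := by
    refine ae_all_iff.2 fun i => ?_
    exact (measurePreserving_eval (fun i => μ[|P i]) i).quasiMeasurePreserving.ae
      (ae_cond_mem (hPm i))
  have hmem2 : ∀ᵐ ω ∂Qs, ∀ j, ω j ∈ Q j := by
    refine ae_all_iff.2 fun j => ?_
    exact (measurePreserving_eval (fun j => ν[|Q j]) j).quasiMeasurePreserving.ae
      (ae_cond_mem (hQm j))
  have hb := norm_integral_le_of_norm_le_const (μ := Ps.prod Qs)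
    (f := fun ω => ∑ i, ∑ j, y i * (Ψ (ω.1 i, ω.2 j) * α i j) * x j)
    (C := c * N * √(∑ i, ‖y i‖ ^ 2) * √(∑ j, ‖x j‖ ^ 2)) (by
      filter_upwards [ae_fst hmem1, ae_snd hmem2] with ω h1 h2
      refine h.norm_sum_sample_le hc ?_ ?_ hN hα y x
      · intro i i' hii
        by_contra hne
        exact Set.disjoint_left.1 (hPd hne) (h1 i) (by rw [hii]; exact h1 i')
      · intro i i' hii
        by_contra hne
        exact Set.disjoint_left.1 (hQd hne) (h2 i) (by rw [hii]; exact h2 i'))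
  simpa using hb

end Sampling

/-! ### Trace pairings as continuous functions on `L²`. -/

section L2Operators

set_option linter.unusedSectionVars false

open InnerProductSpace ComplexConjugate

variable {S T : Type*} [MeasurableSpace S] [MeasurableSpace T] {μ : Measure S} {ν : Measure T}
  [SigmaFinite μ] [SigmaFinite ν]

theorem memLp_two_mul_of_bound {X : Type*} [MeasurableSpace X] {m : Measure X} {Ψ : X → ℂ} {c : ℝ}
    (hm : AEStronglyMeasurable Ψ m) (hb : ∀ x, ‖Ψ x‖ ≤ c) {k : X → ℂ} (hk : MemLp k 2 m) :
    MemLp (fun x => Ψ x * k x) 2 m :=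
  hk.of_le_mul (hm.mul hk.1) (.of_forall fun x => by
    rw [norm_mul]; exact mul_le_mul_of_nonneg_right (hb x) (norm_nonneg _))

theorem exists_mul_operator {X : Type*} [MeasurableSpace X] {m : Measure X} {Ψ : X → ℂ} {c : ℝ}
    (hm : AEStronglyMeasurable Ψ m) (hb : ∀ x, ‖Ψ x‖ ≤ c) :
    ∃ M : Lp ℂ 2 m →L[ℂ] Lp ℂ 2 m, ∀ k, M k =ᵐ[m] fun x => Ψ x * k x := by
  let M : Lp ℂ 2 m →ₗ[ℂ] Lp ℂ 2 m :=
    { toFun := fun k => (memLp_two_mul_of_bound hm hb (Lp.memLp k)).toLp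
      map_add' := by
        intro f f'
        rw [← MemLp.toLp_add]
        refine MemLp.toLp_congr _ _ ?_
        filter_upwards [Lp.coeFn_add f f'] with z hz
        rw [hz, Pi.add_apply, Pi.add_apply]
        ring
      map_smul' := by
        intro c f
        rw [RingHom.id_apply, ← MemLp.toLp_const_smul]
        refine MemLp.toLp_congr _ _ ?_
        filter_upwards [Lp.coeFn_smul c f] with z hz
        rw [hz, Pi.smul_apply, Pi.smul_apply, smul_eq_mul, smul_eq_mul]
        ring }
  have hM : ∀ k, M k =ᵐ[m] fun x => Ψ x * k x := fun k =>
    (memLp_two_mul_of_bound hm hb (Lp.memLp k)).coeFn_toLp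
  exact ⟨⟨M, continuous_of_ae_eq_mul M (Measure.QuasiMeasurePreserving.id m) hM⟩, hM⟩

theorem exists_tensor_operator : ∃ V : Lp ℂ 2 μ →L[ℂ] Lp ℂ 2 ν →L[ℂ] Lp ℂ 2 (μ.prod ν),
    (∀ f g, V f g =ᵐ[μ.prod ν] fun z => f z.1 * g z.2) ∧ ∀ f g, ‖V f g‖ ≤ ‖f‖ * ‖g‖ := by
  have hm := fun (f : Lp ℂ 2 μ) (g : Lp ℂ 2 ν) => memLp_tensor (Lp.memLp f) (Lp.memLp g)
  let V : Lp ℂ 2 μ →ₗ[ℂ] Lp ℂ 2 ν →ₗ[ℂ] Lp ℂ 2 (μ.prod ν) := LinearMap.mk₂ ℂ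
    (fun f g => (hm f g).toLp)
    (fun f f' g => by
      rw [← MemLp.toLp_add]
      refine MemLp.toLp_congr _ _ ?_
      filter_upwards [ae_fst (ν := ν) (Lp.coeFn_add f f')] with z hz
      rw [hz, Pi.add_apply, Pi.add_apply]
      ring)
    (fun c f g => by
      rw [← MemLp.toLp_const_smul]
      refine MemLp.toLp_congr _ _ ?_
      filter_upwards [ae_fst (ν := ν) (Lp.coeFn_smul c f)] with z hz
      rw [hz, Pi.smul_apply, Pi.smul_apply, smul_eq_mul, smul_eq_mul]
      ring)
    (fun f g g' => by
      rw [← MemLp.toLp_add]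
      refine MemLp.toLp_congr _ _ ?_
      filter_upwards [ae_snd (μ := μ) (Lp.coeFn_add g g')] with z hz
      rw [hz, Pi.add_apply, Pi.add_apply]
      ring)
    (fun c f g => by
      rw [← MemLp.toLp_const_smul]
      refine MemLp.toLp_congr _ _ ?_
      filter_upwards [ae_snd (μ := μ) (Lp.coeFn_smul c g)] with z hz
      rw [hz, Pi.smul_apply, Pi.smul_apply, smul_eq_mul, smul_eq_mul]
      ring)
  have hn : ∀ f g, ‖V f g‖ ≤ ‖f‖ * ‖g‖ := fun f g => by
    change ‖(hm f g).toLp‖ ≤ _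
    rw [Lp.norm_toLp, eLpNorm_tensor (Lp.aestronglyMeasurable f) (Lp.aestronglyMeasurable g),
      ENNReal.toReal_mul, Lp.norm_def, Lp.norm_def]
  exact ⟨V.mkContinuous₂ 1 (fun f g => by rw [one_mul]; exact hn f g),
    fun f g => (hm f g).coeFn_toLp, hn⟩

theorem exists_conj_operator : ∃ C : Lp ℂ 2 μ →L[ℝ] Lp ℂ 2 μ,
    (∀ f, C f =ᵐ[μ] fun x => conj (f x)) ∧ ∀ f, ‖C f‖ ≤ ‖f‖ := by
  have h : ∀ f : Lp ℂ 2 μ, (Complex.conjCLE : ℂ →L[ℝ] ℂ).compLpL 2 μ f =ᵐ[μ]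
      fun x => conj (f x) := fun f => by
    filter_upwards [(Complex.conjCLE : ℂ →L[ℝ] ℂ).coeFn_compLpL (p := 2) (μ := μ) f] with x hx
    rw [hx]
    rfl
  refine ⟨(Complex.conjCLE : ℂ →L[ℝ] ℂ).compLpL 2 μ, h, fun f => ?_⟩
  refine Lp.norm_le_norm_of_ae_le ?_
  filter_upwards [h f] with x hx
  rw [hx, RCLike.norm_conj]

/-- Trace pairings of bounded multiples of a kernel, as continuous functions. -/
theorem exists_pairing_eq_inner {Ψ : S × T → ℂ} {c : ℝ}
    (hm : AEStronglyMeasurable Ψ (μ.prod ν)) (hb : ∀ z, ‖Ψ z‖ ≤ c) :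
    ∃ (M : Lp ℂ 2 (μ.prod ν) →L[ℂ] Lp ℂ 2 (μ.prod ν))
      (V : Lp ℂ 2 μ →L[ℂ] Lp ℂ 2 ν →L[ℂ] Lp ℂ 2 (μ.prod ν)) (C : Lp ℂ 2 ν →L[ℝ] Lp ℂ 2 ν),
      (∀ f g, V f g =ᵐ[μ.prod ν] fun z => f z.1 * g z.2) ∧ (∀ f g, ‖V f g‖ ≤ ‖f‖ * ‖g‖) ∧
      (∀ g, C g =ᵐ[ν] fun t => conj (g t)) ∧ (∀ g, ‖C g‖ ≤ ‖g‖) ∧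
      ∀ (w : Lp ℂ 2 μ) (e : Lp ℂ 2 ν) (K : Lp ℂ 2 (μ.prod ν)) (k : S × T → ℂ),
        K =ᵐ[μ.prod ν] k → inner ℂ (V w (C e)) (M K) =
          ∫ z, Ψ z * k z * (conj (w z.1) * e z.2) ∂(μ.prod ν) := by
  obtain ⟨M, hM⟩ := exists_mul_operator hm hb
  obtain ⟨V, hV, hVn⟩ := exists_tensor_operator (μ := μ) (ν := ν)
  obtain ⟨C, hC, hCn⟩ := exists_conj_operator (μ := ν)
  refine ⟨M, V, C, hV, hVn, hC, hCn, fun w e K k hK => ?_⟩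
  rw [L2.inner_def]
  refine integral_congr_ae ?_
  filter_upwards [hM K, hV w (C e), ae_snd (μ := μ) (hC e), hK] with z h1 h2 h3 h4
  rw [h1, h2, h3, h4, RCLike.inner_apply, map_mul, Complex.conj_conj]

end L2Operators

/-! ### Step functions on a common partition. -/

section StepFamilies

set_option linter.unusedSectionVars false

open InnerProductSpace ComplexConjugate

variable {S T : Type*} [MeasurableSpace S] [MeasurableSpace T] {μ : Measure S} {ν : Measure T}

/-- The normalized indicator function of a set of finite measure. -/
noncomputable def normalizedIndicator {P : Set S} (hm : MeasurableSet P) (ht : μ P ≠ ∞) :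
    Lp ℂ 2 μ :=
  indicatorConstLp 2 hm ht (((√(μ.real P))⁻¹ : ℝ) : ℂ)

theorem coeFn_normalizedIndicator {P : Set S} (hm : MeasurableSet P) (ht : μ P ≠ ∞) :
    normalizedIndicator hm ht =ᵐ[μ] P.indicator fun _ => (((√(μ.real P))⁻¹ : ℝ) : ℂ) :=
  indicatorConstLp_coeFn

theorem orthonormal_normalizedIndicator {I : Type*} {P : I → Set S} (hm : ∀ i, MeasurableSet (P i))
    (ht : ∀ i, μ (P i) ≠ ∞) (h0 : ∀ i, μ (P i) ≠ 0)
    (hd : Pairwise (Function.onFun Disjoint P)) :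
    Orthonormal ℂ fun i => normalizedIndicator (hm i) (ht i) := by
  refine ⟨fun i => ?_, fun i j hij => ?_⟩
  · have h1 : 0 < μ.real (P i) := ENNReal.toReal_pos (h0 i) (ht i)
    simp only [normalizedIndicator]
    rw [norm_indicatorConstLp (by norm_num) (by norm_num), Complex.norm_real,
      Real.norm_of_nonneg (by positivity)]
    simp only [ENNReal.toReal_ofNat]
    rw [← Real.sqrt_eq_rpow, inv_mul_cancel₀ (Real.sqrt_pos.2 h1).ne']
  · simp only [normalizedIndicator]
    rw [L2.inner_indicatorConstLp_indicatorConstLp (hm i) (hm j) (ht i) (ht j)]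
    simp [Set.disjoint_iff_inter_eq_empty.1 (hd hij)]

/-- Finite families of functions which are constant on the sets of a finite disjoint family. -/
def IsStepFamily {κ : Type*} (v : κ → Lp ℂ 2 μ) : Prop :=
  ∃ (I : Type) (_ : Fintype I) (P : I → Set S) (hm : ∀ i, MeasurableSet (P i))
    (ht : ∀ i, μ (P i) ≠ ∞) (a : κ → I → ℂ), (∀ i, μ (P i) ≠ 0) ∧
    Pairwise (Function.onFun Disjoint P) ∧
    ∀ k, v k = ∑ i, a k i • normalizedIndicator (hm i) (ht i)

theorem coeFn_sum_smul {I : Type*} [Fintype I] (a : I → ℂ) (E : I → Lp ℂ 2 μ) :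
    (∑ i, a i • E i : Lp ℂ 2 μ) =ᵐ[μ] fun x => ∑ i, a i * E i x := by
  have h1 : ∀ᵐ x ∂μ, ∀ i, (a i • E i : Lp ℂ 2 μ) x = a i * E i x :=
    ae_all_iff.2 fun i => Lp.coeFn_smul (a i) (E i)
  filter_upwards [Lp.coeFn_finsetSum Finset.univ fun i => a i • E i, h1] with x hx hx1
  rw [hx]
  simp only [Finset.sum_apply, hx1]

/-- Approximating the single vector valued function `s ↦ (v k s)` by a simple function gives all
members the same level sets. -/
theorem dense_isStepFamily {κ : Type} [Fintype κ] :
    Dense {v : κ → Lp ℂ 2 μ | IsStepFamily v} := by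
  classical
  rw [Metric.dense_iff]
  intro v ε hε
  have hV : MemLp (fun s k => v k s) 2 μ := memLp_pi_iff.2 fun k => Lp.memLp (v k)
  obtain ⟨φ, hφ, hφm⟩ := hV.exists_simpleFunc_eLpNorm_sub_lt (by norm_num)
    (ENNReal.ofReal_pos.2 hε).ne'
  -- The level set of `0` may have infinite measure, and null level sets cannot be normalized; both
  -- are discarded without changing the functions a.e.
  set I := {y : κ → ℂ // y ∈ φ.range ∧ y ≠ 0 ∧ μ (φ ⁻¹' {y}) ≠ 0} with hI
  have hfin : Finite I := by
    refine Finite.of_injective (fun y : I => (⟨y.1, y.2.1⟩ : φ.range)) fun y y' h => ?_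
    exact Subtype.ext (congrArg (fun q : φ.range => (q : κ → ℂ)) h)
  have : Fintype I := Fintype.ofFinite I
  have hm : ∀ y : I, MeasurableSet (φ ⁻¹' {y.1}) := fun y => φ.measurableSet_preimage _
  have ht : ∀ y : I, μ (φ ⁻¹' {y.1}) ≠ ∞ := fun y =>
    (SimpleFunc.measure_preimage_lt_top_of_memLp (by norm_num) (by norm_num) φ hφm y.1 y.2.2.1).ne
  set a : κ → I → ℂ := fun k y => y.1 k * (√(μ.real (φ ⁻¹' {y.1})) : ℝ)
  set v' : κ → Lp ℂ 2 μ := fun k => ∑ y, a k y • normalizedIndicator (hm y) (ht y) with hv'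
  have hae : ∀ k, v' k =ᵐ[μ] fun s => φ s k := by
    intro k
    have h1 : ∀ᵐ s ∂μ, ∀ y : I, normalizedIndicator (hm y) (ht y) s = (φ ⁻¹' {y.1}).indicator
        (fun _ => (((√(μ.real (φ ⁻¹' {y.1})))⁻¹ : ℝ) : ℂ)) s :=
      ae_all_iff.2 fun y => coeFn_normalizedIndicator (hm y) (ht y)
    have h2 : ∀ᵐ s ∂μ, ∀ y : φ.range, μ (φ ⁻¹' {y.1}) = 0 → φ s ≠ y.1 := by
      refine ae_all_iff.2 fun y => ?_
      by_cases hy : μ (φ ⁻¹' {y.1}) = 0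
      · filter_upwards [measure_eq_zero_iff_ae_notMem.1 hy] with s hs _
        exact hs
      · simp [hy]
    filter_upwards [coeFn_sum_smul (a k) fun y => normalizedIndicator (hm y) (ht y), h1, h2]
      with s hs1 hs2 hs3
    rw [hs1]
    simp only [hs2]
    have hpos : ∀ y : I, (√(μ.real (φ ⁻¹' {y.1})) : ℂ) ≠ 0 := fun y => by
      have : 0 < μ.real (φ ⁻¹' {y.1}) := ENNReal.toReal_pos y.2.2.2 (ht y)
      exact_mod_cast (Real.sqrt_pos.2 this).ne'
    by_cases h0 : φ s = 0
    · rw [h0]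
      refine Finset.sum_eq_zero fun y _ => ?_
      rw [Set.indicator_of_notMem, mul_zero]
      intro hy
      exact y.2.2.1 (by rw [← show φ s = y.1 from hy, h0])
    · let y₀ : I := ⟨φ s, φ.mem_range_self s, h0, fun hz => hs3 ⟨φ s, φ.mem_range_self s⟩ hz rfl⟩
      rw [Finset.sum_eq_single y₀]
      · rw [Set.indicator_of_mem (show s ∈ φ ⁻¹' {y₀.1} from rfl)]
        simp only [a]
        push_cast
        rw [mul_assoc, mul_inv_cancel₀ (hpos y₀), mul_one]
      · intro y _ hy
        rw [Set.indicator_of_notMem, mul_zero]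
        intro hs
        exact hy (Subtype.ext (show φ s = y.1 from hs).symm)
      · simp
  refine ⟨v', ?_, I, this, fun y => φ ⁻¹' {y.1}, hm, ht, a, fun y => y.2.2.2, ?_, fun k => rfl⟩
  · rw [Metric.mem_ball, dist_pi_lt_iff hε]
    intro k
    rw [dist_comm, Lp.dist_def]
    refine (ENNReal.lt_ofReal_iff_toReal_lt ?_).1 (lt_of_le_of_lt ?_ hφ)
    · exact ((Lp.memLp (v k)).sub (Lp.memLp (v' k))).2.ne
    · refine eLpNorm_mono_ae ?_
      filter_upwards [hae k] with s hs
      rw [Pi.sub_apply, Pi.sub_apply, hs]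
      exact norm_le_pi_norm ((fun k => v k s) - φ s) k
  · intro y y' hy
    refine Set.disjoint_left.2 fun s hs hs' => hy (Subtype.ext ?_)
    exact (show φ s = y.1 from hs).symm.trans hs'

end StepFamilies

/-! ### From discrete Schur bounds to the tensor form bound. -/

section StepBound

set_option linter.unusedSectionVars false

open InnerProductSpace ComplexConjugate

variable {S T : Type*} [MeasurableSpace S] [MeasurableSpace T] {μ : Measure S} {ν : Measure T}

theorem Orthonormal.norm_sum_smul {E ι : Type*} [NormedAddCommGroup E] [InnerProductSpace ℂ E]
    [Fintype ι] {e : ι → E} (he : Orthonormal ℂ e) (a : ι → ℂ) :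
    ‖∑ i, a i • e i‖ = √(∑ i, ‖a i‖ ^ 2) := by
  refine ((Real.sqrt_eq_iff_mul_self_eq (by positivity) (norm_nonneg _)).2 ?_).symm
  have h1 := he.inner_sum a a Finset.univ
  rw [← sq, @norm_sq_eq_re_inner ℂ, h1]
  simp only [Complex.conj_mul']
  norm_cast

theorem continuous_rankOne {E F : Type*} [NormedAddCommGroup E] [InnerProductSpace ℂ E]
    [NormedAddCommGroup F] [InnerProductSpace ℂ F] :
    Continuous fun p : E × F => rankOne ℂ p.1 p.2 :=
  (ContinuousLinearMap.smulRightL ℂ F E).continuous₂.comp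
    (((innerSL ℂ).continuous.comp continuous_snd).prodMk continuous_fst)

/-- Disjointness removes the cross terms, and the square of `1 / √(μ P)` is the density of the
normalized measure on the cell. -/
theorem sum_smul_normalizedIndicator_mul {I : Type*} [Fintype I] {P : I → Set S}
    {hm : ∀ i, MeasurableSet (P i)} {ht : ∀ i, μ (P i) ≠ ∞}
    (hd : Pairwise (Function.onFun Disjoint P)) (a b : I → ℂ) :
    ∀ᵐ s ∂μ, (∑ i, a i • normalizedIndicator (hm i) (ht i) : Lp ℂ 2 μ) s *
        (∑ i, b i • normalizedIndicator (hm i) (ht i) : Lp ℂ 2 μ) s =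
        ∑ i, a i * b i * ((P i).indicator (fun _ => (μ.real (P i))⁻¹) s : ℝ) ∧
      (∑ i, a i • normalizedIndicator (hm i) (ht i) : Lp ℂ 2 μ) s *
        conj ((∑ i, b i • normalizedIndicator (hm i) (ht i) : Lp ℂ 2 μ) s) =
        ∑ i, a i * conj (b i) * ((P i).indicator (fun _ => (μ.real (P i))⁻¹) s : ℝ) := by
  have h1 : ∀ᵐ s ∂μ, ∀ i, normalizedIndicator (hm i) (ht i) s =
      (P i).indicator (fun _ => (((√(μ.real (P i)))⁻¹ : ℝ) : ℂ)) s :=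
    ae_all_iff.2 fun i => coeFn_normalizedIndicator (hm i) (ht i)
  filter_upwards [h1, coeFn_sum_smul a fun i => normalizedIndicator (hm i) (ht i),
    coeFn_sum_smul b fun i => normalizedIndicator (hm i) (ht i)] with s hs hs1 hs2
  rw [hs1, hs2]
  simp only [hs]
  have key : ∀ a b : I → ℂ, (∑ i, a i * (P i).indicator (fun _ => (((√(μ.real (P i)))⁻¹ : ℝ) : ℂ)) s) *
      (∑ i, b i * (P i).indicator (fun _ => (((√(μ.real (P i)))⁻¹ : ℝ) : ℂ)) s) =
      ∑ i, a i * b i * ((P i).indicator (fun _ => (μ.real (P i))⁻¹) s : ℝ) := by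
    intro a b
    rw [Finset.sum_mul_sum]
    refine Finset.sum_congr rfl fun i _ => ?_
    rw [Finset.sum_eq_single i]
    · by_cases hi : s ∈ P i
      · simp only [Set.indicator_of_mem hi]
        have : ((√(μ.real (P i)))⁻¹ : ℝ) * (√(μ.real (P i)))⁻¹ = (μ.real (P i))⁻¹ := by
          rw [← mul_inv, Real.mul_self_sqrt measureReal_nonneg]
        rw [← this]
        push_cast
        ring
      · simp [Set.indicator_of_notMem hi]
    · intro j _ hj
      by_cases hi : s ∈ P i
      · rw [Set.indicator_of_notMem (a := s) (s := P j) (fun h => Set.disjoint_left.1 (hd hj) h hi)]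
        simp
      · simp [Set.indicator_of_notMem hi]
    · simp
  refine ⟨key a b, ?_⟩
  rw [← key, map_sum]
  congr 1
  refine Finset.sum_congr rfl fun i _ => ?_
  rw [map_mul]
  by_cases hi : s ∈ P i
  · rw [Set.indicator_of_mem hi, Complex.conj_ofReal]
  · rw [Set.indicator_of_notMem hi, map_zero]

/-- The coefficients are the matrix entries of the finite rank operator `K` between two orthonormal
systems. -/
theorem norm_sum_coefficient_le {E H I J : Type*} [NormedAddCommGroup E] [InnerProductSpace ℂ E]
    [NormedAddCommGroup H] [InnerProductSpace ℂ H] [Fintype I] [Fintype J] {n : ℕ}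
    {p : I → H} (hp : Orthonormal ℂ p) {q : J → E} (hq : Orthonormal ℂ q) (a : Fin n → I → ℂ)
    (b : Fin n → J → ℂ) (y : I → ℂ) (x : J → ℂ) :
    ‖∑ i, ∑ j, y i * (∑ k, conj (a k i) * b k j) * x j‖ ≤
      ‖∑ k, rankOne ℂ (∑ j, b k j • q j) (∑ i, a k i • p i)‖ *
        √(∑ i, ‖y i‖ ^ 2) * √(∑ j, ‖x j‖ ^ 2) := by
  set K := ∑ k, rankOne ℂ (∑ j, b k j • q j) (∑ i, a k i • p i) with hK
  have h1 : ∑ i, ∑ j, y i * (∑ k, conj (a k i) * b k j) * x j =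
      inner ℂ (∑ j, conj (x j) • q j) (K (∑ i, y i • p i)) := by
    have : ∀ k, inner ℂ (∑ j, conj (x j) • q j)
        ((rankOne ℂ (∑ j, b k j • q j) (∑ i, a k i • p i)) (∑ i, y i • p i)) =
        ∑ i, ∑ j, y i * (conj (a k i) * b k j) * x j := by
      intro k
      rw [rankOne_apply, inner_smul_right, hp.inner_sum, hq.inner_sum, Finset.sum_mul_sum]
      refine Finset.sum_congr rfl fun i _ => Finset.sum_congr rfl fun j _ => ?_
      rw [Complex.conj_conj]
      ring
    rw [hK, _root_.sum_apply, inner_sum]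
    rw [Finset.sum_congr rfl fun k _ => this k,
      Finset.sum_comm (s := (Finset.univ : Finset (Fin n)))]
    refine Finset.sum_congr rfl fun i _ => ?_
    rw [Finset.sum_comm (s := (Finset.univ : Finset (Fin n)))]
    refine Finset.sum_congr rfl fun j _ => ?_
    rw [Finset.mul_sum, Finset.sum_mul]
  rw [h1]
  have h2 : √(∑ j, ‖x j‖ ^ 2) = ‖∑ j, conj (x j) • q j‖ := by
    rw [hq.norm_sum_smul]
    simp only [RCLike.norm_conj]
  rw [h2, ← hp.norm_sum_smul]
  calc _ ≤ ‖∑ j, conj (x j) • q j‖ * ‖K (∑ i, y i • p i)‖ := norm_inner_le_norm _ _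
    _ ≤ ‖∑ j, conj (x j) • q j‖ * (‖K‖ * ‖∑ i, y i • p i‖) := by
        gcongr
        exact K.le_opNorm _
    _ = _ := by ring

theorem integrable_indicator_inv {P : Set S} (hm : MeasurableSet P) (ht : μ P ≠ ∞) :
    Integrable (fun s => ((P.indicator (fun _ => (μ.real P)⁻¹) s : ℝ) : ℂ)) μ :=
  ((integrable_indicator_iff hm).2 (integrableOn_const ht)).ofReal

variable [SigmaFinite μ] [SigmaFinite ν]

/-- The index `none` carries `f` and `g`, while `some k` carries the test vectors, so that all share
one grid. The pairing is then a Schur form of cell averages of `Ψ`, with the coefficients of `f`,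
`g` as test vectors. -/
theorem FiniteSchurBound.norm_sum_integral_le_of_isStepFamily {Ψ : S × T → ℂ} {c : ℝ} (hc : 0 ≤ c)
    (h : FiniteSchurBound Ψ c) (hΨ : AEStronglyMeasurable Ψ (μ.prod ν)) {n : ℕ}
    {v : Option (Fin n) → Lp ℂ 2 μ} {u : Option (Fin n) → Lp ℂ 2 ν} (hv : IsStepFamily v)
    (hu : IsStepFamily u) :
    ‖∑ k, ∫ z, Ψ z * (v none z.1 * u none z.2) * (conj (v (some k) z.1) * u (some k) z.2)
        ∂(μ.prod ν)‖ ≤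
      c * ‖v none‖ * ‖u none‖ * ‖∑ k, rankOne ℂ (u (some k)) (v (some k))‖ := by
  obtain ⟨I, _, P, hPm, hPt, a, hP0, hPd, hva⟩ := hv
  obtain ⟨J, _, Q, hQm, hQt, b, hQ0, hQd, hub⟩ := hu
  have hp := orthonormal_normalizedIndicator hPm hPt hP0 hPd
  have hq := orthonormal_normalizedIndicator hQm hQt hQ0 hQd
  simp only [hva, hub]
  set m : I → J → ℂ := fun i j => ∫ z, Ψ z * (((P i).indicator (fun _ => (μ.real (P i))⁻¹) z.1 *
    (Q j).indicator (fun _ => (ν.real (Q j))⁻¹) z.2 : ℝ) : ℂ) ∂(μ.prod ν) with hmdef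
  have h1 : ∀ k, ∫ z, Ψ z * ((∑ i, a none i • normalizedIndicator (hPm i) (hPt i) : Lp ℂ 2 μ) z.1 *
      (∑ j, b none j • normalizedIndicator (hQm j) (hQt j) : Lp ℂ 2 ν) z.2) *
      (conj ((∑ i, a (some k) i • normalizedIndicator (hPm i) (hPt i) : Lp ℂ 2 μ) z.1) *
        (∑ j, b (some k) j • normalizedIndicator (hQm j) (hQt j) : Lp ℂ 2 ν) z.2) ∂(μ.prod ν) =
      ∑ i, ∑ j, a none i * (m i j * (conj (a (some k) i) * b (some k) j)) * b none j := by
    intro k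
    have hint : ∀ i j, Integrable (fun z : S × T => Ψ z *
        (((P i).indicator (fun _ => (μ.real (P i))⁻¹) z.1 *
        (Q j).indicator (fun _ => (ν.real (Q j))⁻¹) z.2 : ℝ) : ℂ)) (μ.prod ν) := by
      intro i j
      have := (integrable_indicator_inv (hPm i) (hPt i)).mul_prod
        (integrable_indicator_inv (hQm j) (hQt j))
      simp only [← Complex.ofReal_mul] at this
      exact this.bdd_mul hΨ (.of_forall (h.norm_le hc))
    have e1 : ∀ᵐ z ∂(μ.prod ν), Ψ z *
        ((∑ i, a none i • normalizedIndicator (hPm i) (hPt i) : Lp ℂ 2 μ) z.1 *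
        (∑ j, b none j • normalizedIndicator (hQm j) (hQt j) : Lp ℂ 2 ν) z.2) *
        (conj ((∑ i, a (some k) i • normalizedIndicator (hPm i) (hPt i) : Lp ℂ 2 μ) z.1) *
        (∑ j, b (some k) j • normalizedIndicator (hQm j) (hQt j) : Lp ℂ 2 ν) z.2) =
        ∑ i, ∑ j, (a none i * (conj (a (some k) i) * b (some k) j) * b none j) *
          (Ψ z * (((P i).indicator (fun _ => (μ.real (P i))⁻¹) z.1 *
          (Q j).indicator (fun _ => (ν.real (Q j))⁻¹) z.2 : ℝ) : ℂ)) := by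
      filter_upwards [ae_fst (ν := ν) (sum_smul_normalizedIndicator_mul (hm := hPm) (ht := hPt) hPd
        (a none) (a (some k))), ae_snd (μ := μ) (sum_smul_normalizedIndicator_mul (hm := hQm)
        (ht := hQt) hQd (b none) (b (some k)))] with z hz1 hz2
      rw [mul_assoc (Ψ z), mul_mul_mul_comm, hz1.2, hz2.1, Finset.sum_mul_sum, Finset.mul_sum]
      refine Finset.sum_congr rfl fun i _ => ?_
      rw [Finset.mul_sum]
      refine Finset.sum_congr rfl fun j _ => ?_
      push_cast
      ring
    rw [integral_congr_ae e1, integral_finsetSum _ fun i _ => integrable_finsetSum _ fun j _ =>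
      (hint i j).const_mul _]
    refine Finset.sum_congr rfl fun i _ => ?_
    rw [integral_finsetSum _ fun j _ => (hint i j).const_mul _]
    refine Finset.sum_congr rfl fun j _ => ?_
    rw [integral_const_mul, hmdef]
    ring
  have h2 := h.norm_sum_average_le hc hΨ hPm hQm hPd hQd hP0 hQ0 hPt hQt (norm_nonneg _)
    (norm_sum_coefficient_le hp hq (fun k => a (some k)) fun k => b (some k)) (a none) (b none)
  simp only [h1]
  rw [Finset.sum_comm]
  simp_rw [Finset.sum_comm (s := (Finset.univ : Finset (Fin n))), ← Finset.sum_mul,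
    ← Finset.mul_sum]
  refine h2.trans_eq ?_
  rw [hp.norm_sum_smul, hq.norm_sum_smul]
  ring

/-- Both sides are continuous in all the `L²` vectors jointly, so density of step families suffices.
-/
theorem FiniteSchurBound.tensorFormBound {Ψ : S × T → ℂ} {c : ℝ} (hc : 0 ≤ c)
    (h : FiniteSchurBound Ψ c) (hΨ : AEStronglyMeasurable Ψ (μ.prod ν)) :
    TensorFormBound μ ν Ψ c := by
  obtain ⟨M, V, C, hV, hVn, hC, hCn, hMV⟩ := exists_pairing_eq_inner hΨ (h.norm_le hc)
  intro f g n w e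
  have key : ∀ p : (Option (Fin n) → Lp ℂ 2 μ) × (Option (Fin n) → Lp ℂ 2 ν),
      ‖∑ k, inner ℂ (V (p.1 (some k)) (C (p.2 (some k)))) (M (V (p.1 none) (p.2 none)))‖ ≤
      c * ‖p.1 none‖ * ‖p.2 none‖ * ‖∑ k, rankOne ℂ (p.2 (some k)) (p.1 (some k))‖ := by
    refine (dense_isStepFamily.prod dense_isStepFamily).induction (fun p hp => ?_) ?_
    · simp only [hMV _ _ _ _ (hV _ _)]
      exact h.norm_sum_integral_le_of_isStepFamily hc hΨ hp.1 hp.2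
    · refine isClosed_le ?_ ?_
      · fun_prop
      · refine Continuous.mul (by fun_prop) (continuous_finsetSum _ fun k _ => ?_).norm
        exact continuous_rankOne.comp (f := fun p : (Option (Fin n) → Lp ℂ 2 μ) ×
          (Option (Fin n) → Lp ℂ 2 ν) => (p.2 (some k), p.1 (some k))) (by fun_prop)
  have := key (fun o => o.elim f w, fun o => o.elim g e)
  simp only [hMV _ _ _ _ (hV _ _), Option.elim_none, Option.elim_some] at this
  exact this

end StepBound

/-! ### From product kernels to all trace class kernels. -/

section TraceNormBound

set_option linter.unusedSectionVars false

open InnerProductSpace ComplexConjugate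

variable {S T : Type*} [MeasurableSpace S] [MeasurableSpace T] {μ : Measure S} {ν : Measure T}
  [SigmaFinite μ] [SigmaFinite ν]

theorem kernel_ae_eq_zero_of_integral_eq_zero {k : S × T → ℂ} (hk : MemLp k 2 (μ.prod ν))
    (h : ∀ (w : Lp ℂ 2 μ) (e : Lp ℂ 2 ν), ∫ z, k z * (conj (w z.1) * e z.2) ∂(μ.prod ν) = 0) :
    k =ᵐ[μ.prod ν] 0 := by
  have hmeas : ∀ n, MeasurableSet (spanningSets μ n ×ˢ spanningSets ν n) := fun n =>
    (measurableSet_spanningSets μ n).prod (measurableSet_spanningSets ν n)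
  have h1 : ∀ n, ∀ᵐ z ∂(μ.prod ν), z ∈ spanningSets μ n ×ˢ spanningSets ν n → k z = 0 := by
    intro n
    have : Fact (μ (spanningSets μ n) < ∞) := ⟨measure_spanningSets_lt_top μ n⟩
    have : Fact (ν (spanningSets ν n) < ∞) := ⟨measure_spanningSets_lt_top ν n⟩
    rw [← ae_restrict_iff' (hmeas n), ← Measure.prod_restrict]
    have hi : Integrable k ((μ.restrict (spanningSets μ n)).prod (ν.restrict (spanningSets ν n))) := by
      have := hk.restrict (spanningSets μ n ×ˢ spanningSets ν n)
      rw [← Measure.prod_restrict] at this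
      exact this.integrable one_le_two
    refine ae_eq_zero_of_forall_setIntegral_prod_eq_zero hi fun A B hA hB => ?_
    have hA' := hA.inter (measurableSet_spanningSets μ n)
    have hB' := hB.inter (measurableSet_spanningSets ν n)
    have hAt : μ (A ∩ spanningSets μ n) ≠ ∞ := measure_ne_top_of_subset Set.inter_subset_right
      (measure_spanningSets_lt_top μ n).ne
    have hBt : ν (B ∩ spanningSets ν n) ≠ ∞ := measure_ne_top_of_subset Set.inter_subset_right
      (measure_spanningSets_lt_top ν n).ne
    rw [Measure.prod_restrict, Measure.restrict_restrict (hA.prod hB), Set.prod_inter_prod,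
      ← integral_indicator (hA'.prod hB'), ← h (indicatorConstLp 2 hA' hAt 1)
      (indicatorConstLp 2 hB' hBt 1)]
    refine integral_congr_ae ?_
    filter_upwards [ae_fst (ν := ν) (indicatorConstLp_coeFn (p := 2) (hs := hA') (hμs := hAt)
      (c := (1 : ℂ))), ae_snd (μ := μ) (indicatorConstLp_coeFn (p := 2) (hs := hB') (hμs := hBt)
      (c := (1 : ℂ)))] with z hz1 hz2
    rw [hz1, hz2]
    by_cases ha : z.1 ∈ A ∩ spanningSets μ n
    · by_cases hb : z.2 ∈ B ∩ spanningSets ν n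
      · rw [Set.indicator_of_mem (show z ∈ (A ∩ spanningSets μ n) ×ˢ (B ∩ spanningSets ν n) from
          ⟨ha, hb⟩), Set.indicator_of_mem ha, Set.indicator_of_mem hb]
        simp
      · rw [Set.indicator_of_notMem fun h => hb h.2, Set.indicator_of_notMem hb]
        simp
    · rw [Set.indicator_of_notMem fun h => ha h.1, Set.indicator_of_notMem ha]
      simp
  filter_upwards [ae_all_iff.2 h1] with z hz
  obtain ⟨n, hn1, hn2⟩ := ((eventually_mem_spanningSets μ z.1).and
    (eventually_mem_spanningSets ν z.2)).exists
  exact hz n ⟨hn1, hn2⟩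

/-- The kernels `u n ⊗ conj (v n)` are absolutely summable in `L²`, and uniqueness of kernels
identifies their sum with `h`. Multiplication by `Ψ` is continuous on `L²`, so the tensor bound may
be summed term by term. -/
theorem TensorFormBound.pairingBound_of_hasSum {Ψ : S × T → ℂ} {c : ℝ} (hc : 0 ≤ c)
    (hm : AEStronglyMeasurable Ψ (μ.prod ν)) (hb : ∀ z, ‖Ψ z‖ ≤ c) (hΨ : TensorFormBound μ ν Ψ c)
    {h : S × T → ℂ} (hh : MemLp h 2 (μ.prod ν)) (hΨh : MemLp (fun z => Ψ z * h z) 2 (μ.prod ν))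
    {u : ℕ → Lp ℂ 2 μ} {v : ℕ → Lp ℂ 2 ν}
    (huv : ∀ x, HasSum (fun n => inner ℂ (v n) x • u n) (integralOperator h hh x))
    (hs : ∑' n, ‖u n‖ₑ * ‖v n‖ₑ ≠ ∞) :
    PairingBound (integralOperator _ hΨh) (c * (∑' n, ‖u n‖ₑ * ‖v n‖ₑ).toReal) := by
  obtain ⟨M, V, C, hV, hVn, hC, hCn, hMV⟩ := exists_pairing_eq_inner hm hb
  -- The symbol `1` expresses the unmultiplied pairings, used to compare the sum of the series with
  -- `h`.
  obtain ⟨M', V', C', hV', -, hC', -, hMV'⟩ := exists_pairing_eq_inner (μ := μ) (ν := ν)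
    (Ψ := fun _ => 1) (c := 1) aestronglyMeasurable_const (by simp)
  have hsum : Summable fun n => ‖u n‖ * ‖v n‖ := by
    simpa using ENNReal.summable_toReal hs
  have htsum : (∑' n, ‖u n‖ₑ * ‖v n‖ₑ).toReal = ∑' n, ‖u n‖ * ‖v n‖ := by
    rw [ENNReal.tsum_toReal_eq fun n => by finiteness]
    simp
  have hle : ∀ n, ‖V (u n) (C (v n))‖ ≤ ‖u n‖ * ‖v n‖ := fun n =>
    (hVn _ _).trans (by gcongr; exact hCn _)
  have hH := (Summable.of_norm_bounded hsum hle).hasSum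
  set H : Lp ℂ 2 (μ.prod ν) := ∑' n, V (u n) (C (v n))
  have hVC : ∀ n, V (u n) (C (v n)) =ᵐ[μ.prod ν] fun z => u n z.1 * conj (v n z.2) := fun n => by
    filter_upwards [hV (u n) (C (v n)), ae_snd (μ := μ) (hC (v n))] with z h1 h2
    rw [h1, h2]
  have hHh : H =ᵐ[μ.prod ν] h := by
    have hz := kernel_ae_eq_zero_of_integral_eq_zero ((Lp.memLp H).sub hh) fun w e => by
      simp only [Pi.sub_apply, sub_mul]
      rw [integral_sub (integrable_kernel_mul (Lp.memLp H) w e) (integrable_kernel_mul hh w e),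
        sub_eq_zero, ← inner_integralOperator hh]
      have e1 : HasSum (fun n => inner ℂ w (inner ℂ (v n) e • u n))
          (inner ℂ w (integralOperator h hh e)) := (huv e).mapL (innerSL ℂ w)
      have e2 : HasSum (fun n => inner ℂ (V' w (C' e)) (M' (V (u n) (C (v n)))))
          (inner ℂ (V' w (C' e)) (M' H)) := hH.mapL ((innerSL ℂ (V' w (C' e))).comp M')
      rw [hMV' w e H H .rfl] at e2
      simp only [one_mul] at e2
      refine e2.unique ?_
      convert e1 using 2 with n
      rw [hMV' w e _ _ (hVC n), inner_smul_right, L2.inner_def, L2.inner_def, mul_comm,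
        ← integral_prod_mul]
      refine integral_congr_ae (.of_forall fun z => ?_)
      simp only [RCLike.inner_apply]
      ring
    filter_upwards [hz] with z hz
    exact sub_eq_zero.1 hz
  intro n w e
  have e1 : ∀ k, inner ℂ (w k) (integralOperator _ hΨh (e k)) =
      inner ℂ (V (w k) (C (e k))) (M H) := fun k => by
    rw [inner_integralOperator, hMV _ _ _ _ hHh]
  have e2 : HasSum (fun m => ∑ k, inner ℂ (V (w k) (C (e k))) (M (V (u m) (C (v m)))))
      (∑ k, inner ℂ (w k) (integralOperator _ hΨh (e k))) := by
    simp only [e1]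
    exact hasSum_sum fun k _ => hH.mapL ((innerSL ℂ (V (w k) (C (e k)))).comp M)
  rw [← e2.tsum_eq, htsum]
  have e3 : ∀ m, ‖∑ k, inner ℂ (V (w k) (C (e k))) (M (V (u m) (C (v m))))‖ ≤
      (c * ‖∑ k, rankOne ℂ (e k) (w k)‖) * (‖u m‖ * ‖v m‖) := by
    intro m
    have := hΨ (u m) (C (v m)) n w e
    simp only [← hMV _ _ _ _ (hV _ _)] at this
    refine this.trans ?_
    calc _ ≤ c * ‖u m‖ * ‖v m‖ * ‖∑ k, rankOne ℂ (e k) (w k)‖ := by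
          gcongr
          exact hCn _
      _ = _ := by ring
  refine (tsum_of_norm_bounded (hsum.mul_left _).hasSum e3).trans_eq ?_
  rw [tsum_mul_left]
  ring

theorem FiniteSchurBound.kernelTraceNorm_le {Ψ Φ : S × T → ℂ} {c : ℝ≥0} (hΨ : FiniteSchurBound Ψ c)
    (hΦ : AEStronglyMeasurable Φ (μ.prod ν)) (hae : Ψ =ᵐ[μ.prod ν] Φ) {h : S × T → ℂ}
    (hh : MemLp h 2 (μ.prod ν)) :
    kernelTraceNorm μ ν (fun z => Φ z * h z) ≤ c * kernelTraceNorm μ ν h := by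
  have hm : AEStronglyMeasurable Ψ (μ.prod ν) := hΦ.congr hae.symm
  have hb := hΨ.norm_le (NNReal.coe_nonneg c)
  have hform := hΨ.tensorFormBound (NNReal.coe_nonneg c) hm
  have hΨh := memLp_two_mul_of_bound hm hb hh
  have hae' : (fun z => Ψ z * h z) =ᵐ[μ.prod ν] fun z => Φ z * h z := by
    filter_upwards [hae] with z hz
    rw [hz]
  have hΦh : MemLp (fun z => Φ z * h z) 2 (μ.prod ν) := (memLp_congr_ae hae').1 hΨh
  rw [kernelTraceNorm, dif_pos hΦh, kernelTraceNorm, dif_pos hh,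
    ← integralOperator_congr hΨh hΦh hae']
  -- For `c = 0` the bound must hold even when the trace norm of `h` is infinite, since `0 * ∞ = 0`;
  -- here `Ψ` vanishes identically.
  rcases eq_or_ne c 0 with hc | hc
  · have hz : ∀ z, Ψ z = 0 := fun z => norm_le_zero_iff.1 ((hb z).trans_eq (by simp [hc]))
    have : PairingBound (integralOperator _ hΨh) 0 := fun n w e => by
      simp only [inner_integralOperator, hz]
      simp
    simpa [hc] using this.traceNorm_le le_rfl
  · have hc0 : (c : ℝ≥0∞) ≠ 0 := by simpa using hc
    rw [← ENNReal.div_le_iff' hc0 ENNReal.coe_ne_top]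
    refine le_iInf fun u => le_iInf fun v => le_iInf fun huv => ?_
    by_cases hs : ∑' n, ‖u n‖ₑ * ‖v n‖ₑ = ∞
    · simp [hs]
    · rw [ENNReal.div_le_iff' hc0 ENNReal.coe_ne_top]
      refine ((hform.pairingBound_of_hasSum (NNReal.coe_nonneg c) hm hb hh hΨh huv hs).traceNorm_le
        (mul_nonneg (NNReal.coe_nonneg c) ENNReal.toReal_nonneg)).trans_eq ?_
      rw [ENNReal.ofReal_mul (NNReal.coe_nonneg c), ENNReal.ofReal_toReal hs, ENNReal.ofReal_coe_nnreal]

theorem measureSchurNorm_le_of_finiteSchurBound {Ψ Φ : S × T → ℂ} {c : ℝ≥0}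
    (hΨ : FiniteSchurBound Ψ c) (hΦ : AEStronglyMeasurable Φ (μ.prod ν))
    (hae : Ψ =ᵐ[μ.prod ν] Φ) : measureSchurNorm μ ν Φ ≤ c :=
  iInf₂_le c fun _ hh => hΨ.kernelTraceNorm_le hΦ hae hh

/-- For fixed vectors the inequality is closed in the constant, so it passes from admissible
constants to their infimum. -/
theorem tensorFormBound_measureSchurNorm {Φ : S × T → ℂ} (hΦ : measureSchurNorm μ ν Φ ≠ ∞) :
    TensorFormBound μ ν Φ (measureSchurNorm μ ν Φ).toNNReal := by
  intro f g n w e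
  have hlim : Filter.Tendsto (fun ε : ℝ => ((measureSchurNorm μ ν Φ).toNNReal + ε) * ‖f‖ * ‖g‖ *
      ‖∑ k, rankOne ℂ (e k) (w k)‖) (nhdsWithin 0 (Set.Ioi 0))
      (nhds (((measureSchurNorm μ ν Φ).toNNReal + 0) * ‖f‖ * ‖g‖ *
        ‖∑ k, rankOne ℂ (e k) (w k)‖)) :=
    Filter.Tendsto.mono_left (Continuous.tendsto (by fun_prop) 0) nhdsWithin_le_nhds
  rw [add_zero] at hlim
  refine ge_of_tendsto hlim ?_
  filter_upwards [self_mem_nhdsWithin] with ε hε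
  have h1 : measureSchurNorm μ ν Φ < measureSchurNorm μ ν Φ + ENNReal.ofReal ε :=
    ENNReal.lt_add_right hΦ (ENNReal.ofReal_pos.2 hε).ne'
  nth_rw 1 [measureSchurNorm] at h1
  simp only [iInf_lt_iff] at h1
  obtain ⟨c, hc, hlt⟩ := h1
  refine (tensorFormBound_of_kernelTraceNorm_le hc f g n w e).trans ?_
  have h2 : (c : ℝ) ≤ (measureSchurNorm μ ν Φ).toNNReal + ε := by
    have := ENNReal.toReal_mono (by finiteness) hlt.le
    rwa [ENNReal.toReal_add hΦ (by finiteness), ENNReal.toReal_ofReal (le_of_lt hε)] at this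
  gcongr

end TraceNormBound

theorem mainTheorem3 {S T : Type*} [MeasurableSpace S] [MeasurableSpace T]
    (μ : Measure S) (ν : Measure T) [SigmaFinite μ] [SigmaFinite ν]
    (Φ : S × T → ℂ) (hΦ : IsMeasureSchurMultiplier μ ν Φ) :
    ∃ Φ₀ : S × T → ℂ, IsDiscreteSchurMultiplier Φ₀ ∧ Φ₀ =ᵐ[μ.prod ν] Φ ∧
      discreteSchurNorm Φ₀ = measureSchurNorm μ ν Φ ∧ measureSchurNorm μ ν Φ < ∞ := by
  -- The crude constant `c` serves only to prove that the measure norm is finite.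
  obtain ⟨c, hc⟩ := exists_tensorFormBound hΦ
  obtain ⟨Ψ, hΨ, hΨae⟩ := exists_ae_eq_finiteSchurBound hΦ (NNReal.coe_nonneg c) hc
  have hfin : measureSchurNorm μ ν Φ < ∞ :=
    (measureSchurNorm_le_of_finiteSchurBound hΨ hΦ.1 hΨae).trans_lt ENNReal.coe_lt_top
  -- The second construction uses the optimal constant, so the discrete norm does not exceed the
  -- measure norm.
  obtain ⟨Φ₀, hΦ₀, hae⟩ := exists_ae_eq_finiteSchurBound hΦ (NNReal.coe_nonneg _)
    (tensorFormBound_measureSchurNorm hfin.ne)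
  have hprod := hΦ₀.exists_isSchurProduct (NNReal.coe_nonneg _)
  refine ⟨Φ₀, fun A => (hprod A).imp fun _ hB => hB.1, hae, le_antisymm ?_ ?_, hfin⟩
  · exact (iInf₂_le (measureSchurNorm μ ν Φ).toNNReal hprod).trans_eq (ENNReal.coe_toNNReal hfin.ne)
  · exact le_iInf₂ fun a ha => measureSchurNorm_le_of_finiteSchurBound
      (finiteSchurBound_of_exists_isSchurProduct ha) hΦ.1 hae
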